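/- A subset of $\mathbb{R}^m$ is *semialgebraic* if it is a finite union of sets of the form $\{x\in\mathbb{R}^m : f(x)=0,\ g_1(x)>0,\dots,g_\ell(x)>0\}$ with $f,g_1,\dots,g_\ell$ real polynomials. For semialgebraic sets $M\subset\mathbb{R}^m$ and $N\subset\mathbb{R}^n$, a *semialgebraic map* $\pi:M\to N$ is a continuous map whose graph is a semialgebraic subset of $\mathbb{R}^{m+n}$, and $\mathcal{S}(M)$ denotes the ring of all continuous functions $M\to\mathbb{R}$ whose graph is semialgebraic. A semialgebraic map $\pi:M\to N$ induces the ring homomorphism $\varphi_\pi:\mathcal{S}(N)\to\mathcal{S}(M)$, $f\mapsto f\circ\pi$, through which $\mathcal{S}(M)$ is regarded as an $\mathcal{S}(N)$-algebra. The homomorphism $\varphi_\pi$ is *simple* if $\mathcal{S}(M)=\mathcal{S}(N)[g]$ for some $g\in\mathcal{S}(M)$, that is, if every element of $\mathcal{S}(M)$ has the form $\sum_{i=0}^{d}(f_i\circ\pi)\,g^i$ with $d\ge 0$ and $f_0,\dots,f_d\in\mathcal{S}(N)$; it is *finite* if $\mathcal{S}(M)$ is a finitely generated $\mathcal{S}(N)$-module.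 The map $\pi$ is *locally injective* if $M$ is covered by open semialgebraic subsets of $M$ on each of which $\pi$ is injective. **Theorem.** Let $\pi:M\to N$ be a surjective semialgebraic map between compact semialgebraic sets $M\subset\mathbb{R}^m$ and $N\subset\mathbb{R}^n$ such that $\varphi_\pi:\mathcal{S}(N)\to\mathcal{S}(M)$ is simple. Then $\pi$ is locally injective. Moreover, every $g\in\mathcal{S}(M)$ with $\mathcal{S}(M)=\mathcal{S}(N)[g]$ is integral over $\mathcal{S}(N)$, and $\varphi_\pi$ is finite. -/

import Mathlib

/-! ### Semialgebraic sets -/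

/-- Basic semialgebraic sets `{f = 0, g₁ > 0, …, g_ℓ > 0}`. The coordinates are indexed by an
arbitrary type; `ι = Fin m` gives subsets of `ℝ^m`. -/
def IsBasicSemialgebraic {ι : Type*} (S : Set (ι → ℝ)) : Prop :=
  ∃ (f : MvPolynomial ι ℝ) (G : Finset (MvPolynomial ι ℝ)),
    S = {x | MvPolynomial.eval x f = 0 ∧ ∀ g ∈ G, 0 < MvPolynomial.eval x g}

/-- Semialgebraic sets: finite unions of basic semialgebraic sets. -/
def IsSemialgebraic {ι : Type*} (S : Set (ι → ℝ)) : Prop :=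
  ∃ F : Set (Set (ι → ℝ)), F.Finite ∧ (∀ B ∈ F, IsBasicSemialgebraic B) ∧ S = ⋃₀ F

namespace SemialgAux

/-! ### Real univariate polynomials -/

theorem lt_of_deriv_pos (p : Polynomial ℝ) {a b : ℝ} (hab : a < b)
    (h : ∀ u ∈ Set.Ioo a b, 0 < p.derivative.eval u) : p.eval a < p.eval b := by
  have := strictMonoOn_of_deriv_pos (convex_Icc a b) (f := fun u => p.eval u)
    p.continuous.continuousOn (by
      intro u hu
      rw [interior_Icc] at hu
      simpa using h u hu)
  exact this (Set.left_mem_Icc.2 hab.le) (Set.right_mem_Icc.2 hab.le) hab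

theorem lt_of_deriv_neg (p : Polynomial ℝ) {a b : ℝ} (hab : a < b)
    (h : ∀ u ∈ Set.Ioo a b, p.derivative.eval u < 0) : p.eval b < p.eval a := by
  have := lt_of_deriv_pos (-p) hab (by intro u hu; simpa using h u hu)
  simpa using this

theorem eq_zero_of_Icc (p : Polynomial ℝ) {a b : ℝ} (hab : a < b)
    (h : ∀ u ∈ Set.Icc a b, p.eval u = 0) : p = 0 := by
  apply Polynomial.eq_zero_of_infinite_isRoot
  exact (Set.Icc_infinite hab).mono fun u hu => h u hu

theorem sign_le_of_le {x y : ℝ} (h : x ≤ y) : SignType.sign x ≤ SignType.sign y :=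
  SignType.sign.monotone h

theorem sign_const (p : Polynomial ℝ) {a b : ℝ} (hab : a ≤ b)
    (h : ∀ u ∈ Set.Icc a b, p.eval u ≠ 0) :
    SignType.sign (p.eval b) = SignType.sign (p.eval a) := by
  have ha := h a (Set.left_mem_Icc.2 hab)
  have hb := h b (Set.right_mem_Icc.2 hab)
  rcases lt_or_gt_of_ne ha with ha | ha <;> rcases lt_or_gt_of_ne hb with hb | hb
  · rw [sign_neg ha, sign_neg hb]
  · obtain ⟨u, hu, h0⟩ := intermediate_value_Icc hab (f := fun u => p.eval u)
      p.continuous.continuousOn (show (0 : ℝ) ∈ Set.Icc _ _ from ⟨ha.le, hb.le⟩)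
    exact absurd h0 (h u hu)
  · obtain ⟨u, hu, h0⟩ := intermediate_value_Icc' hab (f := fun u => p.eval u)
      p.continuous.continuousOn (show (0 : ℝ) ∈ Set.Icc _ _ from ⟨hb.le, ha.le⟩)
    exact absurd h0 (h u hu)
  · rw [sign_pos ha, sign_pos hb]

theorem thom (n : ℕ) : ∀ (p : Polynomial ℝ) (_ : p.natDegree ≤ n) (s t : ℝ)
    (_ : ∀ k, SignType.sign ((Polynomial.derivative^[k] p).eval s)
      = SignType.sign ((Polynomial.derivative^[k] p).eval t)),
    ∀ u ∈ Set.Icc s t, SignType.sign (p.eval u) = SignType.sign (p.eval s) := by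
  induction n with
  | zero =>
    intro p hp s t _ u _
    rw [Polynomial.eq_C_of_natDegree_le_zero hp]; simp
  | succ n ih =>
    intro p hp s t h u hu
    have hd := ih p.derivative ((Polynomial.natDegree_derivative_le p).trans (by omega)) s t
      (fun k => h (k + 1))
    have h0 := h 0
    simp only [Function.iterate_zero, id] at h0
    rcases hu.1.eq_or_lt with rfl | hsu
    · rfl
    rcases hu.2.eq_or_lt with rfl | hut
    · exact h0.symm
    rcases lt_trichotomy (p.derivative.eval s) 0 with hs | hs | hs
    · have hneg : ∀ v ∈ Set.Icc s t, p.derivative.eval v < 0 := by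
        intro v hv; have := hd v hv; rw [sign_neg hs] at this; exact sign_eq_neg_one_iff.1 this
      have h1 := lt_of_deriv_neg p hsu fun v hv => hneg v ⟨hv.1.le, hv.2.le.trans hu.2⟩
      have h2 := lt_of_deriv_neg p hut fun v hv => hneg v ⟨hu.1.trans hv.1.le, hv.2.le⟩
      apply le_antisymm (sign_le_of_le h1.le)
      rw [h0]; exact sign_le_of_le h2.le
    · have hz : p.derivative = 0 := by
        apply eq_zero_of_Icc _ (hsu.trans hut)
        intro v hv; have := hd v hv; rw [hs, sign_zero] at this; exact sign_eq_zero_iff.1 this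
      rw [Polynomial.eq_C_of_derivative_eq_zero hz]; simp
    · have hpos : ∀ v ∈ Set.Icc s t, 0 < p.derivative.eval v := by
        intro v hv; have := hd v hv; rw [sign_pos hs] at this; exact sign_eq_one_iff.1 this
      have h1 := lt_of_deriv_pos p hsu fun v hv => hpos v ⟨hv.1.le, hv.2.le.trans hu.2⟩
      have h2 := lt_of_deriv_pos p hut fun v hv => hpos v ⟨hu.1.trans hv.1.le, hv.2.le⟩
      apply le_antisymm
      · rw [h0]; exact sign_le_of_le h2.le
      · exact sign_le_of_le h1.le

/-- The vector of signs at `t` of a family of polynomials. -/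
noncomputable def V {I : Type*} (G : I → Polynomial ℝ) (t : ℝ) : I → SignType :=
  fun i => SignType.sign ((G i).eval t)

section
variable {I : Type*} {G G' : I → Polynomial ℝ} {δ : I → I}

theorem iter_der (hG : ∀ i, (G i).derivative = G (δ i)) (i : I) (k : ℕ) :
    Polynomial.derivative^[k] (G i) = G (δ^[k] i) := by
  induction k with
  | zero => rfl
  | succ k ih => rw [Function.iterate_succ_apply', ih, hG, Function.iterate_succ_apply']

theorem conv_one (hG : ∀ i, (G i).derivative = G (δ i)) (i : I) {s t : ℝ}
    (h : ∀ k, V G s (δ^[k] i) = V G t (δ^[k] i)) {u : ℝ} (hu : u ∈ Set.Icc s t) :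
    V G u i = V G s i :=
  thom _ (G i) le_rfl s t (fun k => by rw [iter_der hG]; exact h k) u hu

theorem conv (hG : ∀ i, (G i).derivative = G (δ i)) {s t : ℝ}
    (h : V G s = V G t) {u : ℝ} (hu : u ∈ Set.Icc s t) : V G u = V G s :=
  funext fun i => conv_one hG i (fun k => by rw [h]) hu

theorem order_aux (hG : ∀ i, (G i).derivative = G (δ i))
    (hG' : ∀ i, (G' i).derivative = G' (δ i)) {s t s' t' : ℝ} (hst : s < t)
    (hs : V G' s' = V G s) (ht : V G' t' = V G t) (n : ℕ) :
    ∀ i, (G i).natDegree ≤ n → V G s i ≠ V G t i → s' < t' := by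
  induction n with
  | zero =>
    intro i hi hne
    exact absurd (by unfold V; rw [Polynomial.eq_C_of_natDegree_le_zero hi]; simp) hne
  | succ n ih =>
    intro i hi hne
    by_cases hk : ∃ k, V G s (δ^[k] (δ i)) ≠ V G t (δ^[k] (δ i))
    · obtain ⟨k, hk⟩ := hk
      refine ih _ ?_ hk
      rw [← iter_der hG, ← hG]
      exact (Polynomial.natDegree_iterate_derivative _ _).trans
        ((Nat.sub_le _ _).trans ((Polynomial.natDegree_derivative_le _).trans (by omega)))
    push Not at hk
    have c1 : ∀ u ∈ Set.Icc s t, V G u (δ i) = V G s (δ i) := fun u hu => conv_one hG _ hk hu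
    have hk' : ∀ k, V G' t' (δ^[k] (δ i)) = V G' s' (δ^[k] (δ i)) := by
      intro k; rw [hs, ht, hk]
    have c2 : ∀ u ∈ Set.Icc t' s', V G' u (δ i) = V G s (δ i) := fun u hu => by
      rw [conv_one hG' _ hk' hu, ht]; exact (hk 0).symm
    by_contra hlt
    push Not at hlt
    have hlt' : t' < s' := by
      rcases hlt.eq_or_lt with rfl | h
      · exact absurd (by rw [← hs, ← ht]) hne
      · exact h
    rcases lt_trichotomy ((G (δ i)).eval s) 0 with h | h | h
    · have d1 := lt_of_deriv_neg (G i) hst fun u hu => by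
        have := c1 u ⟨hu.1.le, hu.2.le⟩
        unfold V at this; rw [sign_neg h] at this; rw [hG]; exact sign_eq_neg_one_iff.1 this
      have d2 := lt_of_deriv_neg (G' i) hlt' fun u hu => by
        have := c2 u ⟨hu.1.le, hu.2.le⟩
        unfold V at this; rw [sign_neg h] at this; rw [hG']; exact sign_eq_neg_one_iff.1 this
      have e1 : V G t i ≤ V G s i := sign_le_of_le d1.le
      have e2 : V G' s' i ≤ V G' t' i := sign_le_of_le d2.le
      rw [hs, ht] at e2
      exact hne (le_antisymm e2 e1)
    · apply hne
      have hz : (G i).derivative = 0 := by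
        apply eq_zero_of_Icc _ hst
        intro v hv
        have := c1 v hv
        unfold V at this; rw [h, sign_zero] at this; rw [hG]; exact sign_eq_zero_iff.1 this
      unfold V; rw [Polynomial.eq_C_of_derivative_eq_zero hz]; simp
    · have d1 := lt_of_deriv_pos (G i) hst fun u hu => by
        have := c1 u ⟨hu.1.le, hu.2.le⟩
        unfold V at this; rw [sign_pos h] at this; rw [hG]; exact sign_eq_one_iff.1 this
      have d2 := lt_of_deriv_pos (G' i) hlt' fun u hu => by
        have := c2 u ⟨hu.1.le, hu.2.le⟩
        unfold V at this; rw [sign_pos h] at this; rw [hG']; exact sign_eq_one_iff.1 this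
      have e1 : V G s i ≤ V G t i := sign_le_of_le d1.le
      have e2 : V G' t' i ≤ V G' s' i := sign_le_of_le d2.le
      rw [hs, ht] at e2
      exact hne (le_antisymm e1 e2)

theorem order (hG : ∀ i, (G i).derivative = G (δ i))
    (hG' : ∀ i, (G' i).derivative = G' (δ i)) {s t s' t' : ℝ} (hst : s < t)
    (hs : V G' s' = V G s) (ht : V G' t' = V G t) (hne : V G s ≠ V G t) : s' < t' := by
  obtain ⟨i, hi⟩ := Function.ne_iff.1 hne
  exact order_aux hG hG' hst hs ht _ i le_rfl hi

/-- `t` is a root of some nonzero member of the family. -/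
def Rt (G : I → Polynomial ℝ) (t : ℝ) : Prop := ∃ i, G i ≠ 0 ∧ (G i).eval t = 0

theorem V_const {a b : ℝ} (hab : a ≤ b) (h : ∀ u ∈ Set.Icc a b, ¬ Rt G u) : V G b = V G a := by
  funext i
  by_cases hi : G i = 0
  · simp [V, hi]
  · exact sign_const _ hab fun u hu h0 => h u hu ⟨i, hi, h0⟩

theorem V_ne_of_Rt {a b : ℝ} (ha : ¬ Rt G a) (hb : Rt G b) : V G a ≠ V G b := by
  obtain ⟨i, hi, h0⟩ := hb
  intro h
  have := congrFun h i
  unfold V at this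
  rw [h0, sign_zero] at this
  exact ha ⟨i, hi, sign_eq_zero_iff.1 this⟩

theorem V_ne_of_Rt_Rt (hG : ∀ i, (G i).derivative = G (δ i)) {a b : ℝ} (hab : a < b)
    (hb : Rt G b) : V G a ≠ V G b := by
  obtain ⟨i, hi, h0⟩ := hb
  intro h
  apply hi
  apply eq_zero_of_Icc _ hab
  intro u hu
  have := congrFun (conv hG h hu) i
  rw [h] at this
  unfold V at this
  rw [h0, sign_zero] at this
  exact sign_eq_zero_iff.1 this

theorem V_ne_of_Rt_Rt' (hG : ∀ i, (G i).derivative = G (δ i)) {a b : ℝ} (hab : a < b)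
    (ha : Rt G a) : V G a ≠ V G b := by
  obtain ⟨i, hi, h0⟩ := ha
  intro h
  apply hi
  apply eq_zero_of_Icc _ hab
  intro u hu
  have := congrFun (conv hG h hu) i
  unfold V at this
  rw [h0, sign_zero] at this
  exact sign_eq_zero_iff.1 this

theorem nz_of (E : ℝ → ℝ → Prop) (h1 : ∀ t, ∃ t', E t t')
    (hV : ∀ t t', E t t' → V G' t' = V G t) (i : I) (hi : G i ≠ 0) : G' i ≠ 0 := by
  intro h'
  apply hi
  apply eq_zero_of_Icc _ (zero_lt_one (α := ℝ))
  intro u _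
  obtain ⟨t', ht'⟩ := h1 u
  have := congrFun (hV _ _ ht') i
  unfold V at this
  rw [h', Polynomial.eval_zero, sign_zero] at this
  exact sign_eq_zero_iff.1 this.symm

theorem Rt_of (E : ℝ → ℝ → Prop) (h1 : ∀ t, ∃ t', E t t')
    (hV : ∀ t t', E t t' → V G' t' = V G t) {t t' : ℝ} (h : E t t') (ht : Rt G t) : Rt G' t' := by
  obtain ⟨i, hi, h0⟩ := ht
  refine ⟨i, nz_of E h1 hV i hi, ?_⟩
  have := congrFun (hV _ _ h) i
  unfold V at this
  rw [h0, sign_zero] at this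
  exact sign_eq_zero_iff.1 this

theorem finite_Rt [Finite I] (G : I → Polynomial ℝ) : {t | Rt G t}.Finite := by
  have : {t | Rt G t} = ⋃ i, {t | G i ≠ 0 ∧ (G i).eval t = 0} := by
    ext; simp [Rt]
  rw [this]
  apply Set.finite_iUnion
  intro i
  by_cases hi : G i = 0
  · simp [hi]
  · exact (Polynomial.finite_setOfPred_isRoot hi).subset fun t ht => ht.2

theorem right_end [Finite I] (hG : ∀ i, (G i).derivative = G (δ i))
    (hG' : ∀ i, (G' i).derivative = G' (δ i)) (E : ℝ → ℝ → Prop)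
    (h1 : ∀ t, ∃ t', E t t') (h2 : ∀ t', ∃ t, E t t')
    (hV : ∀ t t', E t t' → V G' t' = V G t) {t t' : ℝ} (ht : E t t') (hr : ¬ Rt G t) :
    (∀ u, t' ≤ u → V G' u = V G' t') ∨
    ∃ β β', t < β ∧ t' < β' ∧ E β β' ∧ Rt G β ∧ (∀ u, t ≤ u → u < β → V G u = V G t) ∧
      ∀ u, t' ≤ u → u < β' → V G' u = V G' t' := by
  have hback : ∀ r r', E r r' → Rt G' r' → Rt G r := fun r r' h hr' =>
    Rt_of (fun a b => E b a) h2 (fun a b hab => (hV _ _ hab).symm) h hr'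
  have hr' : ¬ Rt G' t' := fun h => hr (hback _ _ ht h)
  by_cases hZ : ∃ β, t < β ∧ Rt G β
  · right
    have hfin : {r | t < r ∧ Rt G r}.Finite := (finite_Rt G).subset fun r h => h.2
    obtain ⟨β, ⟨hβ, hβr⟩, hmin⟩ := Set.exists_min_image _ id hfin hZ
    obtain ⟨β', hE⟩ := h1 β
    have hβ' : t' < β' := order hG hG' hβ (hV _ _ ht) (hV _ _ hE) (V_ne_of_Rt hr hβr)
    have hβr' := Rt_of E h1 hV hE hβr
    refine ⟨β, β', hβ, hβ', hE, hβr, ?_, ?_⟩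
    · intro u hu huβ
      apply V_const hu
      intro v hv hvr
      rcases hv.1.eq_or_lt with rfl | hlt
      · exact hr hvr
      · exact absurd (hmin v ⟨hlt, hvr⟩) (not_le.2 (hv.2.trans_lt huβ))
    · intro u hu huβ
      apply V_const hu
      intro v hv hvr
      rcases hv.1.eq_or_lt with rfl | hlt
      · exact hr' hvr
      obtain ⟨r, hrE⟩ := h2 v
      have hrr := hback _ _ hrE hvr
      have o1 : t < r := order hG' hG hlt (hV _ _ ht).symm (hV _ _ hrE).symm (V_ne_of_Rt hr' hvr)
      have o2 : r < β := order hG' hG (hv.2.trans_lt huβ) (hV _ _ hrE).symm (hV _ _ hE).symm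
        (V_ne_of_Rt_Rt hG' (hv.2.trans_lt huβ) hβr')
      exact absurd (hmin r ⟨o1, hrr⟩) (not_le.2 o2)
  · left
    intro u hu
    apply V_const hu
    intro v hv hvr
    rcases hv.1.eq_or_lt with rfl | hlt
    · exact hr' hvr
    obtain ⟨r, hrE⟩ := h2 v
    exact hZ ⟨r, order hG' hG hlt (hV _ _ ht).symm (hV _ _ hrE).symm (V_ne_of_Rt hr' hvr),
      hback _ _ hrE hvr⟩

theorem left_end [Finite I] (hG : ∀ i, (G i).derivative = G (δ i))
    (hG' : ∀ i, (G' i).derivative = G' (δ i)) (E : ℝ → ℝ → Prop)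
    (h1 : ∀ t, ∃ t', E t t') (h2 : ∀ t', ∃ t, E t t')
    (hV : ∀ t t', E t t' → V G' t' = V G t) {t t' : ℝ} (ht : E t t') (hr : ¬ Rt G t) :
    (∀ u, u ≤ t' → V G' u = V G' t') ∨
    ∃ α α', α < t ∧ α' < t' ∧ E α α' ∧ Rt G α ∧ (∀ u, u ≤ t → α < u → V G u = V G t) ∧
      ∀ u, u ≤ t' → α' < u → V G' u = V G' t' := by
  have hback : ∀ r r', E r r' → Rt G' r' → Rt G r := fun r r' h hr' =>
    Rt_of (fun a b => E b a) h2 (fun a b hab => (hV _ _ hab).symm) h hr'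
  have hr' : ¬ Rt G' t' := fun h => hr (hback _ _ ht h)
  by_cases hZ : ∃ α, α < t ∧ Rt G α
  · right
    have hfin : {r | r < t ∧ Rt G r}.Finite := (finite_Rt G).subset fun r h => h.2
    obtain ⟨β, ⟨hβ, hβr⟩, hmax⟩ := Set.exists_max_image _ id hfin hZ
    obtain ⟨β', hE⟩ := h1 β
    have hβ' : β' < t' := order hG hG' hβ (hV _ _ hE) (hV _ _ ht) (V_ne_of_Rt hr hβr).symm
    have hβr' := Rt_of E h1 hV hE hβr
    refine ⟨β, β', hβ, hβ', hE, hβr, ?_, ?_⟩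
    · intro u hu huβ
      symm
      apply V_const hu
      intro v hv hvr
      rcases hv.2.eq_or_lt with rfl | hlt
      · exact hr hvr
      · exact absurd (hmax v ⟨hlt, hvr⟩) (not_le.2 (huβ.trans_le hv.1))
    · intro u hu huβ
      symm
      apply V_const hu
      intro v hv hvr
      rcases hv.2.eq_or_lt with rfl | hlt
      · exact hr' hvr
      obtain ⟨r, hrE⟩ := h2 v
      have hrr := hback _ _ hrE hvr
      have o1 : r < t := order hG' hG hlt (hV _ _ hrE).symm (hV _ _ ht).symm
        (V_ne_of_Rt hr' hvr).symm
      have o2 : β < r := order hG' hG (huβ.trans_le hv.1) (hV _ _ hE).symm (hV _ _ hrE).symm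
        (V_ne_of_Rt_Rt' hG' (huβ.trans_le hv.1) hβr')
      exact absurd (hmax r ⟨o1, hrr⟩) (not_le.2 o2)
  · left
    intro u hu
    symm
    apply V_const hu
    intro v hv hvr
    rcases hv.2.eq_or_lt with rfl | hlt
    · exact hr' hvr
    obtain ⟨r, hrE⟩ := h2 v
    exact hZ ⟨r, order hG' hG hlt (hV _ _ hrE).symm (hV _ _ ht).symm (V_ne_of_Rt hr' hvr).symm,
      hback _ _ hrE hvr⟩

theorem pos_at_top (p : Polynomial ℝ) (a : ℝ) (h : ∀ u, a ≤ u → 0 < p.derivative.eval u) :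
    ∃ u, a ≤ u ∧ 0 < p.eval u := by
  have hdeg : 0 < p.degree := by
    by_contra hd
    rw [Polynomial.eq_C_of_degree_le_zero (not_lt.1 hd)] at h
    simpa using h a le_rfl
  rcases le_total 0 p.leadingCoeff with hl | hl
  · have := p.tendsto_atTop_of_leadingCoeff_nonneg hdeg hl
    obtain ⟨u, h1, h2⟩ := ((this.eventually_gt_atTop 0).and
      (Filter.eventually_ge_atTop a)).exists
    exact ⟨u, h2, h1⟩
  · have := p.tendsto_atBot_of_leadingCoeff_nonpos hdeg hl
    obtain ⟨u, h1, h2⟩ := ((this.eventually_lt_atBot (p.eval a)).and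
      (Filter.eventually_gt_atTop a)).exists
    have := lt_of_deriv_pos p h2 fun v hv => h v hv.1.le
    exact absurd this (not_lt.2 h1.le)

theorem neg_at_bot (p : Polynomial ℝ) (a : ℝ) (h : ∀ u, u ≤ a → 0 < p.derivative.eval u) :
    ∃ u, u ≤ a ∧ p.eval u < 0 := by
  obtain ⟨u, hu, h0⟩ := pos_at_top (-(p.comp (-Polynomial.X))) (-a) (by
    intro u hu
    have := h (-u) (by linarith)
    simpa [Polynomial.derivative_comp] using this)
  refine ⟨-u, by linarith, ?_⟩
  simpa using h0

theorem det_pos [Finite I] (hG : ∀ i, (G i).derivative = G (δ i))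
    (hG' : ∀ i, (G' i).derivative = G' (δ i)) (E : ℝ → ℝ → Prop)
    (h1 : ∀ t, ∃ t', E t t') (h2 : ∀ t', ∃ t, E t t')
    (hV : ∀ t t', E t t' → V G' t' = V G t) {t t' : ℝ} (ht : E t t') (hr : ¬ Rt G t)
    (f F : Polynomial ℝ) (ε : ℝ) (i₀ : I)
    (hf : f.derivative = Polynomial.C ε * G i₀) (hF : F.derivative = Polynomial.C ε * G' i₀)
    (hE : ∀ t t', E t t' → Rt G t → SignType.sign (F.eval t') = SignType.sign (f.eval t))
    (hpos : 0 < ε * (G i₀).eval t) :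
    ∃ u, V G' u = V G t ∧ SignType.sign (F.eval u) = SignType.sign (f.eval t) := by
  have dpos : ∀ u, V G u = V G t → 0 < f.derivative.eval u := by
    intro u hu
    have := congrFun hu i₀
    unfold V at this
    rw [hf, Polynomial.eval_mul, Polynomial.eval_C]
    rw [← sign_eq_one_iff, sign_mul, this, ← sign_mul]
    exact sign_pos hpos
  have dpos' : ∀ u, V G' u = V G' t' → 0 < F.derivative.eval u := by
    intro u hu
    rw [hV _ _ ht] at hu
    have := congrFun hu i₀
    unfold V at this
    rw [hF, Polynomial.eval_mul, Polynomial.eval_C]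
    rw [← sign_eq_one_iff, sign_mul, this, ← sign_mul]
    exact sign_pos hpos
  have up : 0 ≤ f.eval t → ∃ u, t' ≤ u ∧ V G' u = V G' t' ∧ 0 < F.eval u := by
    intro h0
    rcases right_end hG hG' E h1 h2 hV ht hr with h | ⟨β, β', hβ, hβ', hEβ, hRβ, hc, hc'⟩
    · obtain ⟨u, hu, hu0⟩ := pos_at_top F t' fun u hu => dpos' u (h u hu)
      exact ⟨u, hu, h u hu, hu0⟩
    · have e1 : f.eval t < f.eval β :=
        lt_of_deriv_pos f hβ fun u hu => dpos u (hc u hu.1.le hu.2)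
      have e2 : 0 < F.eval β' := by
        rw [← sign_eq_one_iff, hE _ _ hEβ hRβ, sign_eq_one_iff]; linarith
      have e3 : ∀ᶠ u in nhdsWithin β' (Set.Iio β'), 0 < F.eval u :=
        (F.continuous.tendsto β').mono_left nhdsWithin_le_nhds |>.eventually_const_lt e2
      obtain ⟨u, hu0, hu⟩ := (e3.and (Ioo_mem_nhdsLT hβ')).exists
      exact ⟨u, hu.1.le, hc' u hu.1.le hu.2, hu0⟩
  have down : f.eval t ≤ 0 → ∃ u, u ≤ t' ∧ V G' u = V G' t' ∧ F.eval u < 0 := by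
    intro h0
    rcases left_end hG hG' E h1 h2 hV ht hr with h | ⟨β, β', hβ, hβ', hEβ, hRβ, hc, hc'⟩
    · obtain ⟨u, hu, hu0⟩ := neg_at_bot F t' fun u hu => dpos' u (h u hu)
      exact ⟨u, hu, h u hu, hu0⟩
    · have e1 : f.eval β < f.eval t :=
        lt_of_deriv_pos f hβ fun u hu => dpos u (hc u hu.2.le hu.1)
      have e2 : F.eval β' < 0 := by
        rw [← sign_eq_neg_one_iff, hE _ _ hEβ hRβ, sign_eq_neg_one_iff]; linarith
      have e3 : ∀ᶠ u in nhdsWithin β' (Set.Ioi β'), F.eval u < 0 :=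
        (F.continuous.tendsto β').mono_left nhdsWithin_le_nhds |>.eventually_lt_const e2
      obtain ⟨u, hu0, hu⟩ := (e3.and (Ioo_mem_nhdsGT hβ')).exists
      exact ⟨u, hu.2.le, hc' u hu.2.le hu.1, hu0⟩
  rcases lt_trichotomy (f.eval t) 0 with h | h | h
  · obtain ⟨u, _, hu, h0⟩ := down h.le
    exact ⟨u, hu.trans (hV _ _ ht), by rw [sign_neg h, sign_neg h0]⟩
  · obtain ⟨a, ha, hVa, ha0⟩ := down h.le
    obtain ⟨b, hb, hVb, hb0⟩ := up h.ge
    obtain ⟨u, hu, h0⟩ := intermediate_value_Icc (ha.trans hb) (f := fun u => F.eval u)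
      F.continuous.continuousOn (show (0 : ℝ) ∈ Set.Icc _ _ from ⟨ha0.le, hb0.le⟩)
    refine ⟨u, ?_, ?_⟩
    · rw [conv hG' (hVa.trans hVb.symm) hu, hVa, hV _ _ ht]
    · simp only at h0
      rw [h, h0]
  · obtain ⟨u, _, hu, h0⟩ := up h.le
    exact ⟨u, hu.trans (hV _ _ ht), by rw [sign_pos h, sign_pos h0]⟩

theorem det [Finite I] (hG : ∀ i, (G i).derivative = G (δ i))
    (hG' : ∀ i, (G' i).derivative = G' (δ i)) (E : ℝ → ℝ → Prop)
    (h1 : ∀ t, ∃ t', E t t') (h2 : ∀ t', ∃ t, E t t')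
    (hV : ∀ t t', E t t' → V G' t' = V G t)
    (f F : Polynomial ℝ) (i₀ : I) (hf : f.derivative = G i₀) (hF : F.derivative = G' i₀)
    (hE : ∀ t t', E t t' → Rt G t → SignType.sign (F.eval t') = SignType.sign (f.eval t))
    (h0 : SignType.sign (F.eval 0) = SignType.sign (f.eval 0)) (t : ℝ) :
    ∃ u, V G' u = V G t ∧ SignType.sign (F.eval u) = SignType.sign (f.eval t) := by
  obtain ⟨t', ht⟩ := h1 t
  by_cases hr : Rt G t
  · exact ⟨t', hV _ _ ht, hE _ _ ht hr⟩
  by_cases hz : G i₀ = 0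
  · have hz' : G' i₀ = 0 := by
      by_contra hne
      exact nz_of (fun a b => E b a) h2 (fun a b hab => (hV _ _ hab).symm) i₀ hne hz
    refine ⟨t', hV _ _ ht, ?_⟩
    rw [hz] at hf
    rw [hz'] at hF
    rw [Polynomial.eq_C_of_derivative_eq_zero hf, Polynomial.eq_C_of_derivative_eq_zero hF] at h0 ⊢
    simpa using h0
  rcases lt_or_gt_of_ne (fun h => hr ⟨i₀, hz, h⟩ : (G i₀).eval t ≠ 0) with h | h
  · obtain ⟨u, hu, hs⟩ := det_pos hG hG' E h1 h2 hV ht hr (-f) (-F) (-1) i₀ (by simp [hf])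
      (by simp [hF]) (by
        intro t t' h h'
        have := hE t t' h h'
        simp only [Polynomial.eval_neg, Left.sign_neg, this]) (by linarith)
    refine ⟨u, hu, ?_⟩
    simpa only [Polynomial.eval_neg, Left.sign_neg, neg_inj] using hs
  · exact det_pos hG hG' E h1 h2 hV ht hr f F 1 i₀ (by simp [hf]) (by simp [hF]) hE (by linarith)

end
end SemialgAux

namespace SemialgAux

/-! ### Boolean operations -/

theorem basic_sa {ι : Type*} {S : Set (ι → ℝ)} (h : IsBasicSemialgebraic S) :
    IsSemialgebraic S :=
  ⟨{S}, Set.finite_singleton _, by simpa using h, by simp⟩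

theorem sa_eq {ι : Type*} (f : MvPolynomial ι ℝ) :
    IsSemialgebraic {x | MvPolynomial.eval x f = 0} :=
  basic_sa ⟨f, ∅, by simp⟩

theorem sa_pos {ι : Type*} (f : MvPolynomial ι ℝ) :
    IsSemialgebraic {x | 0 < MvPolynomial.eval x f} :=
  basic_sa ⟨0, {f}, by simp⟩

theorem sa_empty {ι : Type*} : IsSemialgebraic (∅ : Set (ι → ℝ)) :=
  ⟨∅, Set.finite_empty, by simp, by simp⟩

theorem sa_univ {ι : Type*} : IsSemialgebraic (Set.univ : Set (ι → ℝ)) := by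
  simpa using sa_eq (0 : MvPolynomial ι ℝ)

theorem sa_union {ι : Type*} {S T : Set (ι → ℝ)} (hS : IsSemialgebraic S)
    (hT : IsSemialgebraic T) : IsSemialgebraic (S ∪ T) := by
  obtain ⟨F, hF, hFb, rfl⟩ := hS
  obtain ⟨F', hF', hFb', rfl⟩ := hT
  refine ⟨F ∪ F', hF.union hF', ?_, by rw [Set.sUnion_union]⟩
  rintro B (hB | hB)
  exacts [hFb B hB, hFb' B hB]

theorem basic_inter {ι : Type*} {S T : Set (ι → ℝ)} (hS : IsBasicSemialgebraic S)
    (hT : IsBasicSemialgebraic T) : IsBasicSemialgebraic (S ∩ T) := by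
  classical
  obtain ⟨f, G, rfl⟩ := hS
  obtain ⟨f', G', rfl⟩ := hT
  refine ⟨f * f + f' * f', G ∪ G', ?_⟩
  ext x
  simp only [Set.mem_inter_iff, Set.mem_ofPred_eq, map_add, map_mul, Finset.mem_union]
  constructor
  · rintro ⟨⟨h1, h2⟩, h3, h4⟩
    refine ⟨by simp [h1, h3], ?_⟩
    rintro g (hg | hg)
    exacts [h2 g hg, h4 g hg]
  · rintro ⟨h1, h2⟩
    have := (mul_self_add_mul_self_eq_zero).1 h1
    exact ⟨⟨this.1, fun g hg => h2 g (Or.inl hg)⟩, this.2, fun g hg => h2 g (Or.inr hg)⟩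

theorem sa_inter {ι : Type*} {S T : Set (ι → ℝ)} (hS : IsSemialgebraic S)
    (hT : IsSemialgebraic T) : IsSemialgebraic (S ∩ T) := by
  obtain ⟨F, hF, hFb, rfl⟩ := hS
  obtain ⟨F', hF', hFb', rfl⟩ := hT
  refine ⟨Set.image2 (· ∩ ·) F F', hF.image2 _ hF', ?_, ?_⟩
  · rintro _ ⟨A, hA, B, hB, rfl⟩
    exact basic_inter (hFb A hA) (hFb' B hB)
  · ext x
    simp only [Set.mem_inter_iff, Set.mem_sUnion, Set.mem_image2]
    constructor
    · rintro ⟨⟨A, hA, hx⟩, B, hB, hx'⟩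
      exact ⟨A ∩ B, ⟨A, hA, B, hB, rfl⟩, hx, hx'⟩
    · rintro ⟨_, ⟨A, hA, B, hB, rfl⟩, hx, hx'⟩
      exact ⟨⟨A, hA, hx⟩, B, hB, hx'⟩

theorem sa_biUnion {ι α : Type*} {s : Set α} (hs : s.Finite) {f : α → Set (ι → ℝ)}
    (h : ∀ a ∈ s, IsSemialgebraic (f a)) : IsSemialgebraic (⋃ a ∈ s, f a) := by
  induction s, hs using Set.Finite.induction_on with
  | empty => simpa using sa_empty
  | insert _ _ ih =>
    rw [Set.biUnion_insert]
    exact sa_union (h _ (Set.mem_insert _ _)) (ih fun b hb => h b (Set.mem_insert_of_mem _ hb))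

theorem sa_biInter {ι α : Type*} {s : Set α} (hs : s.Finite) {f : α → Set (ι → ℝ)}
    (h : ∀ a ∈ s, IsSemialgebraic (f a)) : IsSemialgebraic (⋂ a ∈ s, f a) := by
  induction s, hs using Set.Finite.induction_on with
  | empty => simpa using sa_univ
  | insert _ _ ih =>
    rw [Set.biInter_insert]
    exact sa_inter (h _ (Set.mem_insert _ _)) (ih fun b hb => h b (Set.mem_insert_of_mem _ hb))

theorem sa_neg {ι : Type*} (f : MvPolynomial ι ℝ) :
    IsSemialgebraic {x | MvPolynomial.eval x f < 0} := by
  simpa using sa_pos (-f)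

theorem basic_compl {ι : Type*} {S : Set (ι → ℝ)} (hS : IsBasicSemialgebraic S) :
    IsSemialgebraic Sᶜ := by
  obtain ⟨f, G, rfl⟩ := hS
  have : {x | MvPolynomial.eval x f = 0 ∧ ∀ g ∈ G, 0 < MvPolynomial.eval x g}ᶜ =
      ({x | MvPolynomial.eval x f < 0} ∪ {x | 0 < MvPolynomial.eval x f}) ∪
        ⋃ g ∈ (G : Set (MvPolynomial ι ℝ)),
          ({x | MvPolynomial.eval x g < 0} ∪ {x | MvPolynomial.eval x g = 0}) := by
    ext x
    simp only [Set.mem_compl_iff, Set.mem_ofPred_eq, not_and_or, not_forall, not_lt, Set.mem_union,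
      Set.mem_iUnion, ← le_iff_lt_or_eq, lt_or_lt_iff_ne, Finset.mem_coe, ne_eq]
  rw [this]
  exact sa_union (sa_union (sa_neg f) (sa_pos f))
    (sa_biUnion G.finite_toSet fun g _ => sa_union (sa_neg g) (sa_eq g))

theorem sa_compl {ι : Type*} {S : Set (ι → ℝ)} (hS : IsSemialgebraic S) :
    IsSemialgebraic Sᶜ := by
  obtain ⟨F, hF, hFb, rfl⟩ := hS
  have : (⋃₀ F)ᶜ = ⋂ B ∈ F, Bᶜ := by
    ext x; simp
  rw [this]
  exact sa_biInter hF fun B hB => basic_compl (hFb B hB)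

theorem sa_sign {ι : Type*} (f : MvPolynomial ι ℝ) (e : SignType) :
    IsSemialgebraic {x | SignType.sign (MvPolynomial.eval x f) = e} := by
  cases e with
  | zero => simpa [sign_eq_zero_iff] using sa_eq f
  | neg =>
    have : {x | SignType.sign (MvPolynomial.eval x f) = SignType.neg}
      = {x | MvPolynomial.eval x f < 0} := by ext x; exact sign_eq_neg_one_iff
    rw [this]; exact sa_neg f
  | pos =>
    have : {x | SignType.sign (MvPolynomial.eval x f) = SignType.pos}
      = {x | 0 < MvPolynomial.eval x f} := by ext x; exact sign_eq_one_iff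
    rw [this]; exact sa_pos f

theorem sa_preimage {ι κ : Type*} (P : κ → MvPolynomial ι ℝ) {S : Set (κ → ℝ)}
    (hS : IsSemialgebraic S) :
    IsSemialgebraic {x : ι → ℝ | (fun k => MvPolynomial.eval x (P k)) ∈ S} := by
  obtain ⟨F, hF, hFb, rfl⟩ := hS
  have : {x : ι → ℝ | (fun k => MvPolynomial.eval x (P k)) ∈ ⋃₀ F} =
      ⋃ B ∈ F, {x : ι → ℝ | (fun k => MvPolynomial.eval x (P k)) ∈ B} := by
    ext x; simp
  rw [this]
  classical
  refine sa_biUnion hF fun B hB => ?_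
  obtain ⟨f, G, rfl⟩ := hFb B hB
  refine basic_sa ⟨MvPolynomial.bind₁ P f, G.image (MvPolynomial.bind₁ P), ?_⟩
  have key : ∀ (x : ι → ℝ) (g : MvPolynomial κ ℝ),
      MvPolynomial.eval x (MvPolynomial.bind₁ P g)
        = MvPolynomial.eval (fun k => MvPolynomial.eval x (P k)) g := by
    intro x g
    exact MvPolynomial.eval₂Hom_bind₁ (RingHom.id ℝ) x P g
  ext x
  simp [key]

theorem sa_comp {ι κ : Type*} (e : κ → ι) {S : Set (κ → ℝ)} (hS : IsSemialgebraic S) :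
    IsSemialgebraic {x : ι → ℝ | x ∘ e ∈ S} := by
  simpa [Function.comp_def] using sa_preimage (fun k => MvPolynomial.X (R := ℝ) (e k)) hS

/-! ### Elimination of one variable -/

section elim
variable {ι : Type*}

/-- The sign at `t` of a polynomial in one variable whose coefficients are evaluated at `x`. -/
noncomputable def sg (p : Polynomial (MvPolynomial ι ℝ)) (x : ι → ℝ) (t : ℝ) : SignType :=
  SignType.sign ((p.map (MvPolynomial.eval x)).eval t)

/-- The sign conditions on the members of `L` are semialgebraic after projection. -/
def Tame (L : Finset (Polynomial (MvPolynomial ι ℝ))) : Prop :=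
  ∀ ε : Polynomial (MvPolynomial ι ℝ) → SignType,
    IsSemialgebraic {x : ι → ℝ | ∃ t, ∀ p ∈ L, sg p x t = ε p}

theorem tame_of_det {L L' : Finset (Polynomial (MvPolynomial ι ℝ))} (hL' : Tame L')
    (h : ∀ x y : ι → ℝ, (∀ t, ∃ t', ∀ p ∈ L', sg p y t' = sg p x t) →
      (∀ t', ∃ t, ∀ p ∈ L', sg p y t' = sg p x t) →
      ∀ t, ∃ t', ∀ p ∈ L, sg p y t' = sg p x t) : Tame L := by
  classical
  intro ε
  set W : (ι → ℝ) → Set (L' → SignType) :=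
    fun x => {v | ∃ t, ∀ p : L', sg p.1 x t = v p} with hW
  have h1 : ∀ v, IsSemialgebraic {x | v ∈ W x} := by
    intro v
    have := hL' (fun p => if hp : p ∈ L' then v ⟨p, hp⟩ else 0)
    convert this using 5 with x
    simp only [hW, Set.mem_ofPred_eq]
    constructor
    · rintro ⟨t, ht⟩
      exact ⟨t, fun p hp => by rw [dif_pos hp]; exact ht ⟨p, hp⟩⟩
    · rintro ⟨t, ht⟩
      exact ⟨t, fun p => by have := ht p.1 p.2; rwa [dif_pos p.2] at this⟩
  have h2 : ∀ A, IsSemialgebraic {x | W x = A} := by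
    intro A
    have : {x | W x = A} = ⋂ v ∈ (Set.univ : Set (L' → SignType)),
        (if v ∈ A then {x | v ∈ W x} else {x | v ∈ W x}ᶜ) := by
      ext x
      simp only [Set.mem_ofPred_eq, Set.ext_iff, Set.mem_iInter, Set.mem_univ, true_imp_iff]
      refine forall_congr' fun v => ?_
      by_cases hv : v ∈ A <;> simp [hv]
    rw [this]
    refine sa_biInter (Set.toFinite _) fun v _ => ?_
    split_ifs
    exacts [h1 v, sa_compl (h1 v)]
  have h3 : ∀ x y, W x = W y → (∃ t, ∀ p ∈ L, sg p x t = ε p) → ∃ t, ∀ p ∈ L, sg p y t = ε p := by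
    rintro x y hxy ⟨t, ht⟩
    obtain ⟨t', ht'⟩ := h x y (by
      intro t
      have : (fun p : L' => sg p.1 x t) ∈ W y := by rw [← hxy]; exact ⟨t, fun _ => rfl⟩
      obtain ⟨t', ht'⟩ := this
      exact ⟨t', fun p hp => ht' ⟨p, hp⟩⟩) (by
      intro t
      have : (fun p : L' => sg p.1 y t) ∈ W x := by rw [hxy]; exact ⟨t, fun _ => rfl⟩
      obtain ⟨t', ht'⟩ := this
      exact ⟨t', fun p hp => (ht' ⟨p, hp⟩).symm⟩) t
    exact ⟨t', fun p hp => (ht' p hp).trans (ht p hp)⟩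
  have : {x : ι → ℝ | ∃ t, ∀ p ∈ L, sg p x t = ε p} =
      ⋃ A ∈ W '' {x : ι → ℝ | ∃ t, ∀ p ∈ L, sg p x t = ε p}, {x | W x = A} := by
    ext x
    simp only [Set.mem_iUnion, Set.mem_image]
    constructor
    · intro hx; exact ⟨W x, ⟨x, hx, rfl⟩, rfl⟩
    · rintro ⟨_, ⟨y, hy, rfl⟩, hxy⟩
      exact h3 y x (Eq.symm hxy) hy
  rw [this]
  exact sa_biUnion (Set.toFinite _) fun A _ => h2 A

theorem sg_C (c : MvPolynomial ι ℝ) (x : ι → ℝ) (t : ℝ) :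
    sg (Polynomial.C c) x t = SignType.sign (MvPolynomial.eval x c) := by
  simp [sg]

theorem tame_const {L : Finset (Polynomial (MvPolynomial ι ℝ))} (h : ∀ p ∈ L, p.natDegree ≤ 0) :
    Tame L := by
  intro ε
  have : {x : ι → ℝ | ∃ t, ∀ p ∈ L, sg p x t = ε p} =
      ⋂ p ∈ (L : Set (Polynomial (MvPolynomial ι ℝ))),
        {x | SignType.sign (MvPolynomial.eval x (p.coeff 0)) = ε p} := by
    ext x
    simp only [Set.mem_iInter, Set.mem_ofPred_eq, Finset.mem_coe]
    constructor
    · rintro ⟨t, ht⟩ p hp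
      rw [← ht p hp, ← sg_C _ x t, ← Polynomial.eq_C_of_natDegree_le_zero (h p hp)]
    · intro H
      refine ⟨0, fun p hp => ?_⟩
      rw [← H p hp, ← sg_C _ x 0, ← Polynomial.eq_C_of_natDegree_le_zero (h p hp)]
  rw [this]
  exact sa_biInter L.finite_toSet fun p _ => sa_sign _ _

/-- A remainder, valid where the specialization of `g` has degree `k`. -/
theorem exists_rem (g : Polynomial (MvPolynomial ι ℝ)) (k : ℕ) (hk : 1 ≤ k) (n : ℕ) :
    ∀ f : Polynomial (MvPolynomial ι ℝ), f.natDegree ≤ n →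
      ∃ r : Polynomial (MvPolynomial ι ℝ), r.natDegree < k ∧
        ∀ x : ι → ℝ, (g.map (MvPolynomial.eval x)).natDegree = k →
          ∀ t, (g.map (MvPolynomial.eval x)).eval t = 0 → sg r x t = sg f x t := by
  induction n with
  | zero => intro f hf; exact ⟨f, by omega, fun _ _ _ _ => rfl⟩
  | succ n ih =>
    intro f hf
    by_cases hfk : f.natDegree < k
    · exact ⟨f, hfk, fun _ _ _ _ => rfl⟩
    by_cases hfn : f.natDegree ≤ n
    · exact ih f hfn
    have hn : f.natDegree = n + 1 := by omega
    set h : Polynomial (MvPolynomial ι ℝ) :=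
      ∑ i ∈ Finset.range (k + 1), Polynomial.monomial i (g.coeff i) with hh
    have hcoeff : ∀ j, h.coeff j = if j ≤ k then g.coeff j else 0 := by
      intro j
      simp only [hh, Polynomial.finsetSum_coeff, Polynomial.coeff_monomial]
      rw [Finset.sum_ite_eq']
      simp
    set a := g.coeff k with ha
    set f₂ : Polynomial (MvPolynomial ι ℝ) :=
      Polynomial.C (a * a) * f -
        Polynomial.C (a * f.coeff (n + 1)) * (h * Polynomial.X ^ (n + 1 - k)) with hf₂
    have hdeg : f₂.natDegree ≤ n := by
      rw [Polynomial.natDegree_le_iff_coeff_eq_zero]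
      intro N hN
      have e1 : N = (N - (n + 1 - k)) + (n + 1 - k) := by omega
      have e2 : (h * Polynomial.X ^ (n + 1 - k)).coeff N = h.coeff (N - (n + 1 - k)) := by
        conv_lhs => rw [e1]
        rw [Polynomial.coeff_mul_X_pow]
      rw [hf₂, Polynomial.coeff_sub, Polynomial.coeff_C_mul, Polynomial.coeff_C_mul, e2, hcoeff]
      rcases Nat.lt_or_ge (n + 1) N with hlt | hge
      · rw [Polynomial.coeff_eq_zero_of_natDegree_lt (by omega), if_neg (by omega)]; ring
      · have : N = n + 1 := by omega
        subst this
        have e3 : n + 1 - (n + 1 - k) = k := by omega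
        rw [e3, if_pos le_rfl, ← ha]; ring
    obtain ⟨r, hr, hr'⟩ := ih f₂ hdeg
    refine ⟨r, hr, fun x hx t ht => ?_⟩
    rw [hr' x hx t ht]
    have hmap : h.map (MvPolynomial.eval x) = g.map (MvPolynomial.eval x) := by
      ext j
      rw [Polynomial.coeff_map, hcoeff]
      split_ifs with hj
      · rw [Polynomial.coeff_map]
      · rw [map_zero, Polynomial.coeff_eq_zero_of_natDegree_lt (by omega)]
    have hapos : 0 < MvPolynomial.eval x a * MvPolynomial.eval x a := by
      apply mul_self_pos.2
      have : (g.map (MvPolynomial.eval x)).leadingCoeff ≠ 0 := by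
        rw [Polynomial.leadingCoeff_ne_zero]
        rintro h0
        rw [h0, Polynomial.natDegree_zero] at hx
        omega
      rwa [Polynomial.leadingCoeff, hx, Polynomial.coeff_map] at this
    unfold sg
    have : (f₂.map (MvPolynomial.eval x)).eval t =
        MvPolynomial.eval x a * MvPolynomial.eval x a * (f.map (MvPolynomial.eval x)).eval t := by
      rw [hf₂]
      simp only [Polynomial.map_sub, Polynomial.map_mul, Polynomial.map_C, Polynomial.eval_sub,
        Polynomial.eval_mul, Polynomial.eval_C, map_mul, hmap, ht]
      ring
    rw [this, sign_mul, sign_pos hapos, one_mul]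

theorem tame_insert (d : ℕ) (f : Polynomial (MvPolynomial ι ℝ)) (hf : f.natDegree ≤ d + 1)
    (A B : Finset (Polynomial (MvPolynomial ι ℝ)))
    (hA : ∀ p ∈ A, p.natDegree ≤ d) (hB : ∀ p ∈ B, p.natDegree ≤ d + 1)
    (ih : ∀ A' : Finset (Polynomial (MvPolynomial ι ℝ)), (∀ p ∈ A', p.natDegree ≤ d) →
      ∃ L' : Finset (Polynomial (MvPolynomial ι ℝ)), A' ⊆ L' ∧ B ⊆ L' ∧ Tame L')
    (L : Finset (Polynomial (MvPolynomial ι ℝ))) (hL : ∀ p ∈ L, p = f ∨ p ∈ A ∨ p ∈ B) :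
    Tame L := by
  classical
  choose! rem hrem hrem' using fun (g : Polynomial (MvPolynomial ι ℝ)) (k : ℕ) (hk : 1 ≤ k) =>
    exists_rem g k hk _ f le_rfl
  set U : Finset (Polynomial (MvPolynomial ι ℝ)) := insert f (A ∪ B) with hU
  have hUd : ∀ p ∈ U, p.natDegree ≤ d + 1 := by
    intro p hp
    simp only [hU, Finset.mem_insert, Finset.mem_union] at hp
    rcases hp with rfl | hp | hp
    exacts [hf, (hA p hp).trans (by omega), hB p hp]
  set D : Finset (Polynomial (MvPolynomial ι ℝ)) :=
    U.biUnion fun p => (Finset.range (d + 2)).image fun k => Polynomial.derivative^[k + 1] p with hD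
  have hDd : ∀ p ∈ D, p.natDegree ≤ d := by
    intro p hp
    simp only [hD, Finset.mem_biUnion, Finset.mem_image] at hp
    obtain ⟨q, hq, k, _, rfl⟩ := hp
    have := Polynomial.natDegree_iterate_derivative q (k + 1)
    have := hUd q hq
    omega
  set G : Finset (Polynomial (MvPolynomial ι ℝ)) := (A ∪ D) ∪ B with hGdef
  have hGd : ∀ p ∈ G, p.natDegree ≤ d + 1 := by
    intro p hp
    simp only [hGdef, Finset.mem_union] at hp
    rcases hp with (hp | hp) | hp
    exacts [(hA p hp).trans (by omega), (hDd p hp).trans (by omega), hB p hp]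
  have hUD : ∀ p ∈ U, Polynomial.derivative p ∈ D := by
    intro p hp
    simp only [hD, Finset.mem_biUnion, Finset.mem_image, Finset.mem_range]
    exact ⟨p, hp, 0, by omega, rfl⟩
  have hder : ∀ p ∈ G, Polynomial.derivative p ∈ G := by
    intro p hp
    have : Polynomial.derivative p ∈ D := by
      simp only [hGdef, Finset.mem_union] at hp
      rcases hp with (hp | hp) | hp
      · exact hUD p (by simp [hU, hp])
      · simp only [hD, Finset.mem_biUnion, Finset.mem_image, Finset.mem_range] at hp ⊢
        obtain ⟨q, hq, k, hk, rfl⟩ := hp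
        refine ⟨q, hq, ?_⟩
        have hqd := hUd q hq
        rcases Nat.lt_or_ge (k + 1) (d + 2) with h | h
        · exact ⟨k + 1, h, by rw [Function.iterate_succ_apply']⟩
        · refine ⟨k, hk, ?_⟩
          rw [Polynomial.iterate_derivative_eq_zero (by omega), Polynomial.derivative_zero]
      · exact hUD p (by simp [hU, hp])
    simp [hGdef, this]
  set K : Finset (Polynomial (MvPolynomial ι ℝ)) :=
    (insert f G).biUnion fun g => (Finset.range (d + 2)).image fun k => Polynomial.C (g.coeff k)
    with hK
  set Q : Finset (Polynomial (MvPolynomial ι ℝ)) :=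
    G.biUnion fun g => (Finset.Icc 1 (d + 1)).image fun k => rem g k with hQ
  obtain ⟨L', hAL, hBL, hT⟩ := ih (A ∪ D ∪ (K ∪ Q)) (by
    intro p hp
    simp only [Finset.mem_union] at hp
    rcases hp with (hp | hp) | hp | hp
    · exact hA p hp
    · exact hDd p hp
    · simp only [hK, Finset.mem_biUnion, Finset.mem_image] at hp
      obtain ⟨g, _, k, _, rfl⟩ := hp
      simp
    · simp only [hQ, Finset.mem_biUnion, Finset.mem_image, Finset.mem_Icc] at hp
      obtain ⟨g, _, k, hk, rfl⟩ := hp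
      have := hrem g k hk.1
      omega)
  have hGL : ∀ p ∈ G, p ∈ L' := by
    intro p hp
    simp only [hGdef, Finset.mem_union] at hp
    rcases hp with hp | hp
    · exact hAL (by simp only [Finset.mem_union]; tauto)
    · exact hBL hp
  have hKL : ∀ g ∈ insert f G, ∀ k, k ≤ d + 1 → Polynomial.C (g.coeff k) ∈ L' := by
    intro g hg k hk
    apply hAL
    simp only [Finset.mem_union]
    right; left
    simp only [hK, Finset.mem_biUnion, Finset.mem_image, Finset.mem_range]
    exact ⟨g, hg, k, by omega, rfl⟩
  have hQL : ∀ g ∈ G, ∀ k, 1 ≤ k → k ≤ d + 1 → rem g k ∈ L' := by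
    intro g hg k hk hk'
    apply hAL
    simp only [Finset.mem_union]
    right; right
    simp only [hQ, Finset.mem_biUnion, Finset.mem_image, Finset.mem_Icc]
    exact ⟨g, hg, k, ⟨hk, hk'⟩, rfl⟩
  refine tame_of_det hT fun x y h1 h2 t => ?_
  have hsgK : ∀ g ∈ insert f G, ∀ k, k ≤ d + 1 →
      SignType.sign (MvPolynomial.eval y (g.coeff k)) =
        SignType.sign (MvPolynomial.eval x (g.coeff k)) := by
    intro g hg k hk
    obtain ⟨t', ht'⟩ := h1 0
    have := ht' _ (hKL g hg k hk)
    rwa [sg_C, sg_C] at this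
  have hnd : ∀ g ∈ G, (g.map (MvPolynomial.eval y)).natDegree
      = (g.map (MvPolynomial.eval x)).natDegree := by
    have aux : ∀ g ∈ G, ∀ j, (g.map (MvPolynomial.eval y)).coeff j = 0 ↔
        (g.map (MvPolynomial.eval x)).coeff j = 0 := by
      intro g hg j
      rw [Polynomial.coeff_map, Polynomial.coeff_map]
      rcases Nat.lt_or_ge (d + 1) j with hj | hj
      · rw [Polynomial.coeff_eq_zero_of_natDegree_lt ((hGd g hg).trans_lt hj)]; simp
      · rw [← sign_eq_zero_iff, hsgK g (Finset.mem_insert_of_mem hg) j hj, sign_eq_zero_iff]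
    intro g hg
    apply le_antisymm
    · rw [Polynomial.natDegree_le_iff_coeff_eq_zero]
      intro N hN
      rw [aux g hg, Polynomial.coeff_eq_zero_of_natDegree_lt hN]
    · rw [Polynomial.natDegree_le_iff_coeff_eq_zero]
      intro N hN
      rw [← aux g hg, Polynomial.coeff_eq_zero_of_natDegree_lt hN]
  obtain ⟨u, hu, hs⟩ := det (I := G)
    (G := fun i => i.1.map (MvPolynomial.eval x)) (G' := fun i => i.1.map (MvPolynomial.eval y))
    (δ := fun i => ⟨Polynomial.derivative i.1, hder i.1 i.2⟩)
    (fun i => Polynomial.derivative_map _ _) (fun i => Polynomial.derivative_map _ _)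
    (fun t t' => ∀ p ∈ L', sg p y t' = sg p x t) h1 h2
    (fun t t' h => funext fun i => h i.1 (hGL i.1 i.2))
    (f.map (MvPolynomial.eval x)) (f.map (MvPolynomial.eval y))
    ⟨Polynomial.derivative f, by simp [hGdef, hUD f (by simp [hU])]⟩
    (Polynomial.derivative_map _ _) (Polynomial.derivative_map _ _)
    (by
      rintro a b hab ⟨⟨g, hg⟩, hne, h0⟩
      simp only at hne h0
      have hdeg1 : 1 ≤ (g.map (MvPolynomial.eval x)).natDegree := by
        by_contra hlt
        rw [Polynomial.eq_C_of_natDegree_le_zero (by omega :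
          (g.map (MvPolynomial.eval x)).natDegree ≤ 0)] at h0 hne
        rw [Polynomial.eval_C] at h0
        rw [h0] at hne
        simp at hne
      have hdeg2 : (g.map (MvPolynomial.eval x)).natDegree ≤ d + 1 :=
        Polynomial.natDegree_map_le.trans (hGd g hg)
      have e1 := hrem' g _ hdeg1 x rfl a h0
      have h0' : (g.map (MvPolynomial.eval y)).eval b = 0 := by
        have := hab g (hGL g hg)
        unfold sg at this
        rw [h0, sign_zero] at this
        exact sign_eq_zero_iff.1 this
      have e2 := hrem' g _ hdeg1 y (hnd g hg) b h0'
      have e3 := hab _ (hQL g hg _ hdeg1 hdeg2)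
      rw [e1, e2] at e3
      exact e3)
    (by
      have := hsgK f (Finset.mem_insert_self _ _) 0 (by omega)
      rwa [← Polynomial.coeff_zero_eq_eval_zero, ← Polynomial.coeff_zero_eq_eval_zero,
        Polynomial.coeff_map, Polynomial.coeff_map])
    t
  refine ⟨u, fun p hp => ?_⟩
  rcases hL p hp with rfl | h
  · exact hs
  · have hpG : p ∈ G := by
      simp only [hGdef, Finset.mem_union]
      rcases h with h | h
      exacts [Or.inl (Or.inl h), Or.inr h]
    exact congrFun hu ⟨p, hpG⟩

theorem tame_all (d : ℕ) : ∀ L : Finset (Polynomial (MvPolynomial ι ℝ)),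
    (∀ p ∈ L, p.natDegree ≤ d) → Tame L := by
  classical
  induction d with
  | zero => exact fun L h => tame_const h
  | succ d ih =>
    have main : ∀ B : Finset (Polynomial (MvPolynomial ι ℝ)), (∀ p ∈ B, p.natDegree ≤ d + 1) →
        ∀ A : Finset (Polynomial (MvPolynomial ι ℝ)), (∀ p ∈ A, p.natDegree ≤ d) →
          Tame (A ∪ B) := by
      intro B
      induction B using Finset.induction_on with
      | empty => intro _ A hA; rw [Finset.union_empty]; exact ih A hA
      | insert f B _ ihB =>
        intro hB A hA
        have hB' : ∀ p ∈ B, p.natDegree ≤ d + 1 := fun p hp => hB p (Finset.mem_insert_of_mem hp)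
        refine tame_insert d f (hB f (Finset.mem_insert_self _ _)) A B hA hB'
          (fun A' hA' => ⟨A' ∪ B, Finset.subset_union_left, Finset.subset_union_right,
            ihB hB' A' hA'⟩) _ ?_
        intro p hp
        simp only [Finset.mem_union, Finset.mem_insert] at hp
        tauto
    intro L hL
    simpa using main L hL ∅ (by simp)

end elim

/-! ### Projections -/

theorem sa_proj_option {ι : Type*} {S : Set (Option ι → ℝ)} (hS : IsSemialgebraic S) :
    IsSemialgebraic {x : ι → ℝ | ∃ t : ℝ, (fun o => Option.elim o t x) ∈ S} := by
  classical
  obtain ⟨F, hF, hFb, rfl⟩ := hS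
  have : {x : ι → ℝ | ∃ t : ℝ, (fun o => Option.elim o t x) ∈ ⋃₀ F} =
      ⋃ B ∈ F, {x : ι → ℝ | ∃ t : ℝ, (fun o => Option.elim o t x) ∈ B} := by
    ext x
    simp only [Set.mem_sUnion, Set.mem_ofPred_eq, Set.mem_iUnion]
    tauto
  rw [this]
  refine sa_biUnion hF fun B hB => ?_
  obtain ⟨f, G, rfl⟩ := hFb B hB
  set Φ := MvPolynomial.optionEquivLeft ℝ ι
  by_cases hfG : f ∈ G
  · convert sa_empty (ι := ι)
    ext x
    simp only [Set.mem_ofPred_eq, Set.mem_empty_iff_false, iff_false]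
    rintro ⟨t, h0, hg⟩
    exact (hg f hfG).ne' h0
  set L := (insert f G).image Φ
  have hT : Tame L := tame_all (L.sup Polynomial.natDegree) L
    fun p hp => Finset.le_sup (f := Polynomial.natDegree) hp
  have := hT fun p => if p = Φ f then 0 else 1
  convert this using 5 with x t
  have key : ∀ g, SignType.sign (MvPolynomial.eval (fun o => Option.elim o t x) g)
      = sg (Φ g) x t := by
    intro g
    unfold sg
    rw [← MvPolynomial.optionEquivLeft_elim_eval]
  constructor
  · rintro ⟨h0, hg⟩ p hp
    simp only [L, Finset.mem_image, Finset.mem_insert] at hp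
    obtain ⟨g, rfl | hgG, rfl⟩ := hp
    · rw [if_pos rfl, ← key, h0, sign_zero]
    · rw [if_neg (fun h => hfG (by rwa [Φ.injective h] at hgG)), ← key]
      exact sign_pos (hg g hgG)
  · intro H
    constructor
    · have := H (Φ f) (by simp [L])
      rw [if_pos rfl, ← key] at this
      exact sign_eq_zero_iff.1 this
    · intro g hgG
      have := H (Φ g) (Finset.mem_image_of_mem _ (Finset.mem_insert_of_mem hgG))
      rw [if_neg (fun h => hfG (by rwa [Φ.injective h] at hgG)), ← key] at this
      exact sign_eq_one_iff.1 this

/-- Projections of semialgebraic sets are semialgebraic (Tarski and Seidenberg). -/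
theorem sa_proj {ι : Type*} {κ : Type} [Finite κ] {S : Set (ι ⊕ κ → ℝ)} (hS : IsSemialgebraic S) :
    IsSemialgebraic {x : ι → ℝ | ∃ y : κ → ℝ, Sum.elim x y ∈ S} := by
  revert S
  refine Finite.induction_empty_option (P := fun κ : Type => ∀ {S : Set (ι ⊕ κ → ℝ)},
    IsSemialgebraic S → IsSemialgebraic {x : ι → ℝ | ∃ y : κ → ℝ, Sum.elim x y ∈ S})
    ?_ ?_ ?_ κ
  · intro α β e ih S hS
    have := ih (sa_comp (Sum.map id e.symm) hS)
    convert this using 4 with x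
    constructor
    · rintro ⟨y, hy⟩
      refine ⟨y ∘ e, ?_⟩
      have : Sum.elim x (y ∘ e) ∘ Sum.map id e.symm = Sum.elim x y := by
        ext (i | i) <;> simp
      simpa only [Set.mem_ofPred_eq, this] using hy
    · rintro ⟨y, hy⟩
      refine ⟨y ∘ e.symm, ?_⟩
      have : Sum.elim x y ∘ Sum.map id e.symm = Sum.elim x (y ∘ e.symm) := by
        ext (i | i) <;> simp
      simpa only [Set.mem_ofPred_eq, this] using hy
  · intro S hS
    have := sa_preimage (Sum.elim (fun i : ι => MvPolynomial.X (R := ℝ) i)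
      (fun k : PEmpty => k.elim)) hS
    convert this using 3 with x
    have h : ∀ y : PEmpty → ℝ, Sum.elim x y =
        fun k => MvPolynomial.eval x (Sum.elim (fun i : ι => MvPolynomial.X (R := ℝ) i)
          (fun k : PEmpty => k.elim) k) := by
      intro y; ext (i | i)
      · simp
      · exact i.elim
    constructor
    · rintro ⟨y, hy⟩; rwa [h y] at hy
    · intro hy; exact ⟨fun k => k.elim, by rwa [h]⟩
  · intro α _ ih S hS
    have h1 := sa_proj_option (ι := ι ⊕ α) (sa_comp (fun s : ι ⊕ Option α => match s with
      | Sum.inl i => some (Sum.inl i)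
      | Sum.inr none => none
      | Sum.inr (some a) => some (Sum.inr a)) hS)
    have h2 := ih h1
    convert h2 using 3 with x
    have key : ∀ (t : ℝ) (y : α → ℝ),
        ((fun o => Option.elim o t (Sum.elim x y)) ∘ fun s : ι ⊕ Option α => match s with
          | Sum.inl i => some (Sum.inl i)
          | Sum.inr none => none
          | Sum.inr (some a) => some (Sum.inr a)) =
        Sum.elim x (fun o => Option.elim o t y) := by
      intro t y; ext (i | (_ | i)) <;> rfl
    simp only [Set.mem_ofPred_eq, key]
    constructor
    · rintro ⟨y, hy⟩
      refine ⟨y ∘ some, y none, ?_⟩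
      have : (fun o => Option.elim o (y none) (y ∘ some)) = y := by ext (_ | i) <;> rfl
      rwa [this]
    · rintro ⟨y, t, hy⟩; exact ⟨_, hy⟩

end SemialgAux

/-! ### Semialgebraic maps and the ring of semialgebraic functions -/

/-- The graph of `π : M → N` is a semialgebraic subset of `ℝ^(m+n)`. Continuity is carried
separately, by taking `π : C(M, N)`. -/
def IsSemialgebraicMap {m n : ℕ} {M : Set (Fin m → ℝ)} {N : Set (Fin n → ℝ)} (π : M → N) : Prop :=
  IsSemialgebraic {z : Fin m ⊕ Fin n → ℝ | ∃ x : M, z = Sum.elim (x : Fin m → ℝ) (π x)}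

/-- The graph of `f : M → ℝ` is a semialgebraic subset of `ℝ^(m+1)`. -/
def IsSemialgebraicFun {m : ℕ} {M : Set (Fin m → ℝ)} (f : M → ℝ) : Prop :=
  IsSemialgebraic {z : Fin m ⊕ Unit → ℝ | ∃ x : M, z = Sum.elim (x : Fin m → ℝ) fun _ => f x}

namespace SemialgAux

theorem fun_const {m : ℕ} {M : Set (Fin m → ℝ)} (hM : IsSemialgebraic M) (c : ℝ) :
    IsSemialgebraicFun (fun _ : M => c) := by
  have h := sa_inter (sa_comp (Sum.inl : Fin m → Fin m ⊕ Unit) hM)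
    (sa_eq (MvPolynomial.X (R := ℝ) (Sum.inr () : Fin m ⊕ Unit) - MvPolynomial.C c))
  unfold IsSemialgebraicFun
  convert h using 1
  ext z
  simp only [Set.mem_ofPred_eq, Set.mem_inter_iff, map_sub, MvPolynomial.eval_X,
    MvPolynomial.eval_C, sub_eq_zero]
  constructor
  · rintro ⟨x, rfl⟩
    exact ⟨by simp, rfl⟩
  · rintro ⟨h1, h2⟩
    refine ⟨⟨_, h1⟩, ?_⟩
    ext (i | i)
    · rfl
    · exact h2

theorem fun_poly {m : ℕ} {M : Set (Fin m → ℝ)} {f g : M → ℝ} (hf : IsSemialgebraicFun f)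
    (hg : IsSemialgebraicFun g) (P : MvPolynomial Bool ℝ) :
    IsSemialgebraicFun
      (fun x => MvPolynomial.eval (fun b => cond b (f x) (g x)) P) := by
  have h1 := sa_comp (Sum.elim (fun i => Sum.inl (Sum.inl i)) (fun _ => Sum.inr true) :
    Fin m ⊕ Unit → (Fin m ⊕ Unit) ⊕ Bool) hf
  have h2 := sa_comp (Sum.elim (fun i => Sum.inl (Sum.inl i)) (fun _ => Sum.inr false) :
    Fin m ⊕ Unit → (Fin m ⊕ Unit) ⊕ Bool) hg
  have h3 := sa_eq (MvPolynomial.X (R := ℝ) (Sum.inl (Sum.inr ()) : (Fin m ⊕ Unit) ⊕ Bool) -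
    MvPolynomial.rename Sum.inr P)
  have h := sa_proj (sa_inter (sa_inter h1 h2) h3)
  unfold IsSemialgebraicFun
  convert h using 3 with z
  simp only [Set.mem_inter_iff, Set.mem_ofPred_eq, map_sub, MvPolynomial.eval_X,
    MvPolynomial.eval_rename, sub_eq_zero, Sum.elim_inl, Sum.elim_comp_inr]
  constructor
  · rintro ⟨x, rfl⟩
    refine ⟨fun b => cond b (f x) (g x), ⟨⟨x, ?_⟩, ⟨x, ?_⟩⟩, rfl⟩ <;> ext (i | i) <;> rfl
  · rintro ⟨y, ⟨⟨x, hx⟩, ⟨x', hx'⟩⟩, h0⟩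
    have e1 : ∀ i, z (Sum.inl i) = x.1 i := fun i => congrFun hx (Sum.inl i)
    have e2 : ∀ i, z (Sum.inl i) = x'.1 i := fun i => congrFun hx' (Sum.inl i)
    have e3 : y true = f x := congrFun hx (Sum.inr ())
    have e4 : y false = g x' := congrFun hx' (Sum.inr ())
    have e5 : x' = x := Subtype.ext (funext fun i => (e2 i).symm.trans (e1 i))
    subst e5
    have e6 : (fun b => cond b (f x') (g x')) = y := by ext (_ | _) <;> simp [e3, e4]
    refine ⟨x', ?_⟩
    ext (i | i)
    · exact e1 i
    · rw [e6]; exact h0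

theorem fun_comp {m n : ℕ} {M : Set (Fin m → ℝ)} {N : Set (Fin n → ℝ)} {π : M → N}
    (hπ : IsSemialgebraicMap π) {f : N → ℝ} (hf : IsSemialgebraicFun f) :
    IsSemialgebraicFun (fun x => f (π x)) := by
  have h1 := sa_comp (Sum.elim (fun i => Sum.inl (Sum.inl i)) Sum.inr :
    Fin m ⊕ Fin n → (Fin m ⊕ Unit) ⊕ Fin n) hπ
  have h2 := sa_comp (Sum.elim Sum.inr (fun u => Sum.inl (Sum.inr u)) :
    Fin n ⊕ Unit → (Fin m ⊕ Unit) ⊕ Fin n) hf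
  have h := sa_proj (sa_inter h1 h2)
  unfold IsSemialgebraicFun
  convert h using 3 with z
  simp only [Set.mem_inter_iff, Set.mem_ofPred_eq]
  constructor
  · rintro ⟨x, rfl⟩
    refine ⟨(π x).1, ⟨x, ?_⟩, ⟨π x, ?_⟩⟩ <;> ext (i | i) <;> rfl
  · rintro ⟨y, ⟨x, hx⟩, ⟨w, hw⟩⟩
    have e1 : ∀ i, z (Sum.inl i) = x.1 i := fun i => congrFun hx (Sum.inl i)
    have e2 : ∀ i, y i = (π x).1 i := fun i => congrFun hx (Sum.inr i)
    have e3 : ∀ i, y i = w.1 i := fun i => congrFun hw (Sum.inl i)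
    have e4 : ∀ u, z (Sum.inr u) = f w := fun u => congrFun hw (Sum.inr u)
    have e5 : w = π x := Subtype.ext (funext fun i => (e3 i).symm.trans (e2 i))
    subst e5
    refine ⟨x, ?_⟩
    ext (i | i)
    exacts [e1 i, e4 i]

end SemialgAux

/-- The `ℝ`-algebra `𝒮(M)` of continuous semialgebraic functions on a semialgebraic set `M`. -/
noncomputable def semialgebraicFunctions {m : ℕ} (M : Set (Fin m → ℝ)) (hM : IsSemialgebraic M) :
    Subalgebra ℝ C(M, ℝ) where
  carrier := {f | IsSemialgebraicFun f}
  mul_mem' {f g} hf hg := by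
    have h := SemialgAux.fun_poly hf hg (MvPolynomial.X true * MvPolynomial.X false)
    simp only [map_mul, MvPolynomial.eval_X, cond_true, cond_false] at h
    exact h
  add_mem' {f g} hf hg := by
    have h := SemialgAux.fun_poly hf hg (MvPolynomial.X true + MvPolynomial.X false)
    simp only [map_add, MvPolynomial.eval_X, cond_true, cond_false] at h
    exact h
  algebraMap_mem' r := SemialgAux.fun_const hM r

/-- The homomorphism `φ_π : 𝒮(N) → 𝒮(M)`, `f ↦ f ∘ π`, induced by a semialgebraic map `π`. -/
noncomputable def semialgebraicPullback {m n : ℕ} {M : Set (Fin m → ℝ)} {N : Set (Fin n → ℝ)}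
    (hM : IsSemialgebraic M) (hN : IsSemialgebraic N) (π : C(M, N)) (hπ : IsSemialgebraicMap π) :
    semialgebraicFunctions N hN →ₐ[ℝ] semialgebraicFunctions M hM :=
  ((ContinuousMap.compRightAlgHom ℝ ℝ π).comp (semialgebraicFunctions N hN).val).codRestrict
    (semialgebraicFunctions M hM) fun f => SemialgAux.fun_comp hπ f.2

/-- `B = A[b]`: the evaluation homomorphism `A[t] → B`, `p(t) ↦ p(b)`, is surjective. -/
def IsSimpleGenerator {A B : Type*} [CommRing A] [CommRing B] (φ : A →+* B) (b : B) : Prop :=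
  Function.Surjective (Polynomial.eval₂RingHom φ b)

/-- A ring homomorphism `φ : A → B` is simple if `B = A[b]` for some `b ∈ B`. -/
def IsSimpleRingHom {A B : Type*} [CommRing A] [CommRing B] (φ : A →+* B) : Prop :=
  ∃ b : B, IsSimpleGenerator φ b

/-- `π : M → N` is locally injective: `M` is covered by open semialgebraic subsets of `M` on each
of which `π` is injective. -/
def IsLocallyInjectiveSemialgebraic {m n : ℕ} {M : Set (Fin m → ℝ)} {N : Set (Fin n → ℝ)} (π : M → N) : Prop :=
  ∃ 𝒰 : Set (Set M), ⋃₀ 𝒰 = Set.univ ∧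
    ∀ U ∈ 𝒰, IsOpen U ∧ IsSemialgebraic (Subtype.val '' U) ∧ Set.InjOn π U

/-! Let `g` generate `𝒮(M)` over `𝒮(N)`. Functions of the form `a ∘ π` are constant on the fibres of
`π`. Hence for `f = ∑ (fᵢ ∘ π) gⁱ` and `π x = π y` the difference `f x - f y` is a multiple of `g x
- g y`, and compactness of `M` bounds the quotient: `|f x - f y| ≤ C |g x - g y|` with `C` depending
on `f` alone (`fibre_lipschitz`).

Two kinds of test functions exploit this. The coordinates of `M` show that `g` separates the points
of each fibre (`injective_on_fibre`). The cube root `f` of `g - g x₀` is semialgebraic but not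
Lipschitz in `g` near `x₀`: with `a = f x` and `b = f y` the estimate reads `|a - b| ≤ C |a³ - b³| =
C |a - b| |a² + ab + b²|`. If `|a|, |b| ≤ r` with `r` small, this forces `a = b`, so `g x = g y` and
`x = y`. Thus `π` is injective on the neighbourhood `{|f| ≤ r}` of `x₀` (`exists_injOn`), which is
local injectivity.

For integrality, let `K = {|f| ≤ r}`. The points `(π x, g x)` with `x ∈ K` form a compact
semialgebraic set, and it is the graph of a function because `π` is injective on `K`. A
semialgebraic Tietze theorem (`exists_extension`) extends that function to some `F` with `F ∘ π = g`
on `K` (`exists_factor`). Finitely many such `K` cover `M`, and the monic polynomial `∏ (t - Fᵢ)`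
vanishes at `g`. An integral extension of finite type is finite.

The Tietze extension is explicit. For `φ` with compact graph `A`, let `d(y)` be the least squared
distance from `y` to the domain of `φ`, and off the domain put `E(y) = min_a (φ(a) + c (|y - a|² /
d(y) - 1))`, where `c` exceeds the oscillation of `φ`. The penalty forces a minimiser to be almost
nearest to `y`, which gives continuity at the domain. Minima of polynomials over semialgebraic sets
are semialgebraic by projection. -/

/-! ### Extension of semialgebraic functions from compact sets -/

open Topology Filter

namespace SemialgAux

/-- The graph of the fibrewise minimum of a polynomial over a semialgebraic set. -/
theorem sa_isLeast {ι : Type*} {κ : Type} [Finite κ] {A : Set (κ → ℝ)} (hA : IsSemialgebraic A)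
    (P : MvPolynomial (ι ⊕ κ) ℝ) :
    IsSemialgebraic {z : ι ⊕ Unit → ℝ |
      IsLeast ((fun a => MvPolynomial.eval (Sum.elim (z ∘ Sum.inl) a) P) '' A)
        (z (Sum.inr ()))} := by
  let e : ι ⊕ κ → (ι ⊕ Unit) ⊕ κ := Sum.map Sum.inl id
  let D : MvPolynomial ((ι ⊕ Unit) ⊕ κ) ℝ :=
    MvPolynomial.rename e P - MvPolynomial.X (Sum.inl (Sum.inr ()))
  have hD : ∀ (z : ι ⊕ Unit → ℝ) (a : κ → ℝ), MvPolynomial.eval (Sum.elim z a) D =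
      MvPolynomial.eval (Sum.elim (z ∘ Sum.inl) a) P - z (Sum.inr ()) := by
    intro z a
    have : Sum.elim z a ∘ e = Sum.elim (z ∘ Sum.inl) a := by ext (i | i) <;> rfl
    simp [D, MvPolynomial.eval_rename, this]
  have hA' := sa_comp (Sum.inr : κ → (ι ⊕ Unit) ⊕ κ) hA
  -- Leastness is one existential condition (the value is attained) and one negated existential
  -- condition (no smaller value occurs).
  have h := sa_inter (sa_proj (sa_inter hA' (sa_eq D)))
    (sa_compl (sa_proj (sa_inter hA' (sa_neg D))))
  convert h using 1
  ext z
  simp only [Set.mem_ofPred_eq, Set.mem_inter_iff, Set.mem_compl_iff, hD, Sum.elim_comp_inr,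
    IsLeast, mem_lowerBounds, Set.mem_image, sub_eq_zero, sub_neg, not_exists, not_and, not_lt,
    forall_exists_index, and_imp, forall_apply_eq_imp_iff₂]

/-- The squared Euclidean distance from `y` to the first coordinates of `a`. -/
noncomputable def sqDist {n : ℕ} (y : Fin n → ℝ) (a : Fin n ⊕ Unit → ℝ) : ℝ :=
  ∑ i, (y i - a (Sum.inl i)) ^ 2

theorem sqDist_nonneg {n : ℕ} (y : Fin n → ℝ) (a : Fin n ⊕ Unit → ℝ) : 0 ≤ sqDist y a :=
  Finset.sum_nonneg fun _ _ => sq_nonneg _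

theorem sqDist_eq_zero {n : ℕ} {y : Fin n → ℝ} {a : Fin n ⊕ Unit → ℝ} :
    sqDist y a = 0 ↔ y = a ∘ Sum.inl := by
  unfold sqDist
  rw [Finset.sum_eq_zero_iff_of_nonneg fun _ _ => sq_nonneg _]
  simp [funext_iff, sub_eq_zero]

theorem continuous_sqDist {n : ℕ} :
    Continuous fun p : (Fin n → ℝ) × (Fin n ⊕ Unit → ℝ) => sqDist p.1 p.2 := by
  unfold sqDist; fun_prop

/-! ### Tietze extension by a penalised minimum. -/

section extension
variable {n : ℕ} (A : Set (Fin n ⊕ Unit → ℝ)) (c : ℝ)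

/-- The minimal squared distance to the projection of `A`. -/
noncomputable def minSqDist (y : Fin n → ℝ) : ℝ := sInf (sqDist y '' A)

/-- The numerator of the extension formula. -/
noncomputable def extNum (y : Fin n → ℝ) : ℝ :=
  sInf ((fun a => (a (Sum.inr ()) - c) * minSqDist A y + c * sqDist y a) '' A)

open Classical in
/-- An extension of the function with graph `A`. -/
noncomputable def extFun (y : Fin n → ℝ) : ℝ :=
  if h : ∃ a ∈ A, y = a ∘ Sum.inl then h.choose (Sum.inr ()) else extNum A c y / minSqDist A y

variable {A}

theorem continuous_minSqDist (hc : IsCompact A) : Continuous (minSqDist A) :=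
  hc.continuous_sInf continuous_sqDist

/-- The penalised expression is multiplied through by `minSqDist`, so it stays jointly continuous
where the distance vanishes. The minimum over the compact set `A` is then continuous everywhere, and
division is needed only off the domain. -/
theorem continuous_extNum_integrand (hc : IsCompact A) :
    Continuous fun p : (Fin n → ℝ) × (Fin n ⊕ Unit → ℝ) =>
      (p.2 (Sum.inr ()) - c) * minSqDist A p.1 + c * sqDist p.1 p.2 := by
  have h1 := (continuous_minSqDist hc).comp (continuous_fst (Y := Fin n ⊕ Unit → ℝ))
  have h2 := continuous_sqDist (n := n)
  simp only [Function.comp_def] at h1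
  fun_prop

theorem continuous_extNum (hc : IsCompact A) : Continuous (extNum A c) :=
  hc.continuous_sInf (continuous_extNum_integrand c hc)

theorem isLeast_minSqDist (hc : IsCompact A) (hne : A.Nonempty) (y : Fin n → ℝ) :
    IsLeast (sqDist y '' A) (minSqDist A y) :=
  (hc.image (continuous_sqDist.comp (Continuous.prodMk_right y))).isLeast_sInf (hne.image _)

theorem isLeast_extNum (hc : IsCompact A) (hne : A.Nonempty) (y : Fin n → ℝ) :
    IsLeast ((fun a => (a (Sum.inr ()) - c) * minSqDist A y + c * sqDist y a) '' A)
      (extNum A c y) :=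
  (hc.image ((continuous_extNum_integrand c hc).comp (Continuous.prodMk_right y))).isLeast_sInf
    (hne.image _)

theorem minSqDist_nonneg (hc : IsCompact A) (hne : A.Nonempty) (y : Fin n → ℝ) :
    0 ≤ minSqDist A y := by
  obtain ⟨a, -, h⟩ := (isLeast_minSqDist hc hne y).1
  rw [← h]; exact sqDist_nonneg _ _

/-- The minimum over the compact set `A` is attained, so distance zero means that `y` itself lies
below a point of `A`. -/
theorem minSqDist_eq_zero (hc : IsCompact A) (hne : A.Nonempty) {y : Fin n → ℝ} :
    minSqDist A y = 0 ↔ ∃ a ∈ A, y = a ∘ Sum.inl := by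
  constructor
  · intro h
    obtain ⟨a, ha, h'⟩ := (isLeast_minSqDist hc hne y).1
    exact ⟨a, ha, sqDist_eq_zero.1 (h'.trans h)⟩
  · rintro ⟨a, ha, h⟩
    refine le_antisymm ?_ (minSqDist_nonneg hc hne y)
    exact (isLeast_minSqDist hc hne y).2 ⟨a, ha, sqDist_eq_zero.2 h⟩

theorem extFun_of_mem
    (hfun : ∀ a ∈ A, ∀ b ∈ A, a ∘ Sum.inl = b ∘ Sum.inl → a (Sum.inr ()) = b (Sum.inr ()))
    {a : Fin n ⊕ Unit → ℝ} (ha : a ∈ A) : extFun A c (a ∘ Sum.inl) = a (Sum.inr ()) := by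
  have h : ∃ b ∈ A, a ∘ Sum.inl = b ∘ Sum.inl := ⟨a, ha, rfl⟩
  rw [extFun, dif_pos h]
  exact hfun _ h.choose_spec.1 _ ha h.choose_spec.2.symm

theorem extFun_of_ne (hc : IsCompact A) (hne : A.Nonempty) {y : Fin n → ℝ}
    (hy : minSqDist A y ≠ 0) : extFun A c y = extNum A c y / minSqDist A y := by
  rw [extFun, dif_neg]
  rwa [← minSqDist_eq_zero hc hne]

/-- The values of the extension lie between values at almost nearest points. -/
theorem extFun_between (hc : IsCompact A) (hne : A.Nonempty)
    (hfun : ∀ a ∈ A, ∀ b ∈ A, a ∘ Sum.inl = b ∘ Sum.inl → a (Sum.inr ()) = b (Sum.inr ()))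
    (hb : ∀ a ∈ A, ∀ b ∈ A, a (Sum.inr ()) - b (Sum.inr ()) < c) (y : Fin n → ℝ) :
    ∃ a ∈ A, ∃ b ∈ A, sqDist y a ≤ 2 * minSqDist A y ∧ sqDist y b ≤ 2 * minSqDist A y ∧
      a (Sum.inr ()) ≤ extFun A c y ∧ extFun A c y ≤ b (Sum.inr ()) := by
  by_cases hy : minSqDist A y = 0
  · obtain ⟨a, ha, rfl⟩ := (minSqDist_eq_zero hc hne).1 hy
    have h0 : sqDist (a ∘ Sum.inl) a = 0 := sqDist_eq_zero.2 rfl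
    have := extFun_of_mem c hfun ha
    exact ⟨a, ha, a, ha, by rw [h0, hy]; simp, by rw [h0, hy]; simp, this.ge, this.le⟩
  · have hpos := (minSqDist_nonneg hc hne y).lt_of_ne' hy
    have hcpos : 0 < c := by
      obtain ⟨a, ha⟩ := hne
      simpa using hb a ha a ha
    -- The upper witness `b` is a nearest point, and the lower witness `a` minimises the numerator.
    obtain ⟨b, hbA, hbq⟩ := (isLeast_minSqDist hc hne y).1
    obtain ⟨a, haA, haq⟩ := (isLeast_extNum c hc hne y).1
    have hle := (isLeast_extNum c hc hne y).2 ⟨b, hbA, rfl⟩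
    have hmin := (isLeast_minSqDist hc hne y).2 ⟨a, haA, rfl⟩
    simp only at haq hle
    rw [extFun_of_ne c hc hne hy]
    rw [hbq] at hle
    have hab := hb b hbA a haA
    refine ⟨a, haA, b, hbA, ?_, by linarith, ?_, ?_⟩
    -- At `b` the numerator's integrand is `b (inr ()) * d`, with `d = minSqDist A y`. If the
    -- squared distance to `a` exceeded `2 * d`, its value at `a` would exceed `(a (inr ()) + c) *
    -- d`, which is more than `b (inr ()) * d` because `c` bounds the oscillation. This contradicts
    -- minimality.
    · by_contra hlt
      push Not at hlt
      have h1 := mul_lt_mul_of_pos_left hlt hcpos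
      have h2 := mul_lt_mul_of_pos_right hab hpos
      nlinarith
    · rw [le_div_iff₀ hpos, ← haq]
      nlinarith [mul_le_mul_of_nonneg_left hmin hcpos.le]
    · rw [div_le_iff₀ hpos]
      nlinarith

/-- Off the domain this is a quotient of continuous functions. At a point of the domain, the values
are squeezed between those at almost nearest points, and these converge because `A` is compact and
is a graph. -/
theorem continuous_extFun (hc : IsCompact A) (hne : A.Nonempty)
    (hfun : ∀ a ∈ A, ∀ b ∈ A, a ∘ Sum.inl = b ∘ Sum.inl → a (Sum.inr ()) = b (Sum.inr ()))
    (hb : ∀ a ∈ A, ∀ b ∈ A, a (Sum.inr ()) - b (Sum.inr ()) < c) : Continuous (extFun A c) := by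
  rw [continuous_iff_continuousAt]
  intro y
  by_cases hy : minSqDist A y = 0
  · obtain ⟨a₀, ha₀, rfl⟩ := (minSqDist_eq_zero hc hne).1 hy
    rw [Metric.continuousAt_iff']
    intro ε hε
    -- The part of the graph whose values stay at least `ε` away from the value at the base point.
    have hK : IsCompact (A ∩ {a | ε ≤ dist (a (Sum.inr ())) (a₀ (Sum.inr ()))}) :=
      hc.inter_right (isClosed_le continuous_const (by fun_prop))
    -- At the base point `minSqDist` is zero while `sqDist` is positive on this compact set, since
    -- two graph points over the same base have equal values. So for nearby `y` no point of the set
    -- is almost nearest.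
    have hev := hK.eventually_forall_of_forall_eventually (x₀ := a₀ ∘ Sum.inl)
      (P := fun y a => 2 * minSqDist A y < sqDist y a) (by
        rintro a ⟨haA, ha⟩
        have hcont : Continuous fun p : (Fin n → ℝ) × (Fin n ⊕ Unit → ℝ) => 2 * minSqDist A p.1 :=
          continuous_const.mul ((continuous_minSqDist hc).comp continuous_fst)
        refine (hcont.continuousAt.eventually_lt continuous_sqDist.continuousAt ?_)
        simp only [hy, mul_zero]
        refine (sqDist_nonneg _ _).lt_of_ne' fun h0 => ?_
        have := hfun _ ha₀ _ haA (sqDist_eq_zero.1 h0)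
        rw [Set.mem_ofPred_eq, this, dist_self] at ha
        exact absurd ha (not_le.2 hε))
    filter_upwards [hev] with y hyev
    obtain ⟨a, ha, b, hbA, hqa, hqb, h1, h2⟩ := extFun_between c hc hne hfun hb y
    have key : ∀ a ∈ A, sqDist y a ≤ 2 * minSqDist A y →
        dist (a (Sum.inr ())) (a₀ (Sum.inr ())) < ε := by
      intro a ha hq
      by_contra h
      exact absurd (hyev a ⟨ha, not_lt.1 h⟩) (not_lt.2 hq)
    have ka := abs_lt.1 (key a ha hqa)
    have kb := abs_lt.1 (key b hbA hqb)
    rw [extFun_of_mem c hfun ha₀, Real.dist_eq, abs_lt]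
    exact ⟨by linarith [ka.1], by linarith [kb.2]⟩
  · have h := ((continuous_extNum c hc).continuousAt (x := y)).div
      (continuous_minSqDist hc).continuousAt hy
    refine h.congr ?_
    filter_upwards [(continuous_minSqDist hc).continuousAt.eventually_ne hy] with z hz
    exact (extFun_of_ne c hc hne hz).symm

/-- Over the domain the graph is `A` itself. Elsewhere it is a projection: the denominator and the
numerator become auxiliary variables, each pinned down as the least value of a polynomial. -/
theorem sa_extFun (hA : IsSemialgebraic A) (hc : IsCompact A) (hne : A.Nonempty)
    (hfun : ∀ a ∈ A, ∀ b ∈ A, a ∘ Sum.inl = b ∘ Sum.inl → a (Sum.inr ()) = b (Sum.inr ())) :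
    IsSemialgebraic {z : Fin n ⊕ Unit → ℝ | z (Sum.inr ()) = extFun A c (z ∘ Sum.inl)} := by
  let q : MvPolynomial (Fin n ⊕ (Fin n ⊕ Unit)) ℝ :=
    ∑ i, (MvPolynomial.X (Sum.inl i) - MvPolynomial.X (Sum.inr (Sum.inl i))) ^ 2
  let e : Fin n ⊕ (Fin n ⊕ Unit) → (Fin n ⊕ Unit) ⊕ (Fin n ⊕ Unit) := Sum.map Sum.inl id
  -- The numerator involves `minSqDist`, which is not polynomial. An extra coordinate `Sum.inl
  -- (Sum.inr ())` stands for it, so `sa_isLeast` applies again.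
  let P : MvPolynomial ((Fin n ⊕ Unit) ⊕ (Fin n ⊕ Unit)) ℝ :=
    (MvPolynomial.X (Sum.inr (Sum.inr ())) - MvPolynomial.C c) *
      MvPolynomial.X (Sum.inl (Sum.inr ())) + MvPolynomial.C c * MvPolynomial.rename e q
  have hq : ∀ y a, MvPolynomial.eval (Sum.elim y a) q = sqDist y a := by
    intro y a; simp [q, sqDist]
  have hP : ∀ y a, MvPolynomial.eval (Sum.elim y a) P =
      (a (Sum.inr ()) - c) * y (Sum.inr ()) + c * sqDist (y ∘ Sum.inl) a := by
    intro y a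
    have : Sum.elim y a ∘ e = Sum.elim (y ∘ Sum.inl) a := by ext (i | i) <;> rfl
    simp [P, MvPolynomial.eval_rename, this, hq]
  -- the auxiliary variables `true` and `false` stand for the denominator and the numerator
  have h1 := sa_comp (Sum.map Sum.inl fun _ => true :
    Fin n ⊕ Unit → (Fin n ⊕ Unit) ⊕ Bool) (sa_isLeast hA q)
  have h2 := sa_comp (Sum.elim (Sum.elim (fun i => Sum.inl (Sum.inl i)) fun _ => Sum.inr true)
    (fun _ => Sum.inr false) : (Fin n ⊕ Unit) ⊕ Unit → (Fin n ⊕ Unit) ⊕ Bool) (sa_isLeast hA P)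
  have h3 := sa_compl (sa_eq (MvPolynomial.X (R := ℝ) (Sum.inr true : (Fin n ⊕ Unit) ⊕ Bool)))
  have h4 := sa_eq (MvPolynomial.X (R := ℝ) (Sum.inl (Sum.inr ()) : (Fin n ⊕ Unit) ⊕ Bool) *
    MvPolynomial.X (Sum.inr true) - MvPolynomial.X (Sum.inr false))
  have h := sa_union hA (sa_proj (sa_inter (sa_inter h1 h2) (sa_inter h3 h4)))
  convert h using 1
  ext z
  have m1 : ∀ w : Bool → ℝ, Sum.elim z w ∘ (Sum.map Sum.inl fun _ => true :
      Fin n ⊕ Unit → (Fin n ⊕ Unit) ⊕ Bool) = Sum.elim (z ∘ Sum.inl) fun _ => w true := by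
    intro w; ext (i | i) <;> rfl
  have m2 : ∀ w : Bool → ℝ, Sum.elim z w ∘
      (Sum.elim (Sum.elim (fun i => Sum.inl (Sum.inl i)) fun _ => Sum.inr true)
        (fun _ => Sum.inr false) : (Fin n ⊕ Unit) ⊕ Unit → (Fin n ⊕ Unit) ⊕ Bool) =
      Sum.elim (Sum.elim (z ∘ Sum.inl) fun _ => w true) fun _ => w false := by
    intro w; ext ((i | i) | i) <;> rfl
  simp only [Set.mem_union, Set.mem_ofPred_eq, Set.mem_inter_iff, Set.mem_compl_iff, m1, m2,
    Sum.elim_comp_inl, Sum.elim_inr, Sum.elim_inl, hq, hP, MvPolynomial.eval_X, map_sub, map_mul,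
    sub_eq_zero]
  constructor
  · intro hz
    by_cases hy : minSqDist A (z ∘ Sum.inl) = 0
    · left
      obtain ⟨a, ha, h'⟩ := (minSqDist_eq_zero hc hne).1 hy
      rw [h', extFun_of_mem c hfun ha] at hz
      have : z = a := by
        ext (i | i)
        · exact congrFun h' i
        · exact hz
      rwa [this]
    · right
      refine ⟨fun b => cond b (minSqDist A (z ∘ Sum.inl)) (extNum A c (z ∘ Sum.inl)),
        ⟨isLeast_minSqDist hc hne _, isLeast_extNum c hc hne _⟩, hy, ?_⟩
      rw [hz, extFun_of_ne c hc hne hy]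
      exact div_mul_cancel₀ _ hy
  · rintro (hz | ⟨w, ⟨w1, w2⟩, w3, w4⟩)
    · exact (extFun_of_mem c hfun hz).symm
    · have e1 := w1.unique (isLeast_minSqDist hc hne _)
      rw [e1] at w2 w3 w4
      have e2 := w2.unique (isLeast_extNum c hc hne _)
      rw [extFun_of_ne c hc hne w3, eq_div_iff w3, w4, e2]

end extension

/-- A continuous function with compact semialgebraic graph extends to a continuous semialgebraic
function on the whole space. -/
theorem exists_extension {n : ℕ} {A : Set (Fin n ⊕ Unit → ℝ)} (hA : IsSemialgebraic A)
    (hc : IsCompact A)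
    (hfun : ∀ a ∈ A, ∀ b ∈ A, a ∘ Sum.inl = b ∘ Sum.inl → a (Sum.inr ()) = b (Sum.inr ())) :
    ∃ F : (Fin n → ℝ) → ℝ, Continuous F ∧
      IsSemialgebraic {z : Fin n ⊕ Unit → ℝ | z (Sum.inr ()) = F (z ∘ Sum.inl)} ∧
      ∀ a ∈ A, F (a ∘ Sum.inl) = a (Sum.inr ()) := by
  rcases A.eq_empty_or_nonempty with rfl | hne
  · refine ⟨fun _ => 0, continuous_const, ?_, by simp⟩
    simpa using sa_eq (MvPolynomial.X (R := ℝ) (Sum.inr () : Fin n ⊕ Unit))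
  -- If `|φ| ≤ B`, values of `φ` differ by at most `2 * B`; the summand `1` makes the inequality
  -- strict.
  obtain ⟨B, hB⟩ := hc.exists_bound_of_continuousOn (f := fun a => a (Sum.inr ()))
    (by fun_prop)
  have hb : ∀ a ∈ A, ∀ b ∈ A, a (Sum.inr ()) - b (Sum.inr ()) < 2 * B + 1 := by
    intro a ha b hbA
    have h1 := abs_le.1 (hB a ha)
    have h2 := abs_le.1 (hB b hbA)
    linarith [h1.2, h2.1]
  exact ⟨extFun A (2 * B + 1), continuous_extFun _ hc hne hfun hb, sa_extFun _ hA hc hne hfun,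
    fun a ha => extFun_of_mem _ hfun ha⟩

end SemialgAux

/-! ### Simple homomorphisms -/

/-- Cubing is an order isomorphism of `ℝ`, so its inverse is continuous. The cube root supplies the
test function that fails to be Lipschitz at `0`. -/
theorem exists_continuous_cbrt : ∃ σ : ℝ → ℝ, Continuous σ ∧ ∀ t, σ t ^ 3 = t := by
  have hs : StrictMono fun t : ℝ => t ^ 3 := Odd.strictMono_pow (by decide)
  have hsurj : Function.Surjective fun t : ℝ => t ^ 3 := by
    refine (continuous_pow 3).surjective (tendsto_pow_atTop (by norm_num)) ?_
    have := (tendsto_neg_atTop_atBot (G := ℝ)).comp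
      ((tendsto_pow_atTop (α := ℝ) (n := 3) (by norm_num)).comp tendsto_neg_atBot_atTop)
    refine this.congr fun t => ?_
    simp only [Function.comp_apply]; ring
  let e := hs.orderIsoOfSurjective _ hsurj
  exact ⟨e.symm, e.symm.continuous, fun t => e.apply_symm_apply t⟩

/-- Integral elements are closed under sums and products, and they include the image of `φ` and the
generator `b`. -/
theorem RingHom.isIntegral_of_isSimpleGenerator {A B : Type*} [CommRing A] [CommRing B]
    {φ : A →+* B} {b : B} (h : IsSimpleGenerator φ b) (hb : φ.IsIntegralElem b) :
    φ.IsIntegral := by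
  intro f
  obtain ⟨p, rfl⟩ := h f
  simp only [Polynomial.coe_eval₂RingHom]
  induction p using Polynomial.induction_on with
  | C a => simpa using φ.isIntegralElem_map
  | add p q hp hq => rw [Polynomial.eval₂_add]; exact hp.add _ hq
  | monomial k a hk =>
    rw [pow_succ, ← mul_assoc, Polynomial.eval₂_mul, Polynomial.eval₂_X]
    exact hk.mul _ hb

theorem RingHom.finiteType_of_isSimpleGenerator {A B : Type*} [CommRing A] [CommRing B]
    {φ : A →+* B} {b : B} (h : IsSimpleGenerator φ b) : φ.FiniteType := by
  have h1 : (Polynomial.C : A →+* Polynomial A).FiniteType :=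
    RingHom.finiteType_algebraMap.2 inferInstance
  have h2 := h1.comp_surjective h
  have : (Polynomial.eval₂RingHom φ b).comp Polynomial.C = φ := by ext a; simp
  rwa [this] at h2

namespace SemialgAux

/-! ### Semialgebraicity of the test functions, neighbourhoods and graphs. -/

section
variable {m n : ℕ} {M : Set (Fin m → ℝ)} {N : Set (Fin n → ℝ)}

theorem fun_coord (hM : IsSemialgebraic M) (i : Fin m) :
    IsSemialgebraicFun (fun x : M => (x : Fin m → ℝ) i) := by
  have h := sa_inter (sa_comp (Sum.inl : Fin m → Fin m ⊕ Unit) hM)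
    (sa_eq (MvPolynomial.X (R := ℝ) (Sum.inr () : Fin m ⊕ Unit) - MvPolynomial.X (Sum.inl i)))
  unfold IsSemialgebraicFun
  convert h using 1
  ext z
  simp only [Set.mem_ofPred_eq, Set.mem_inter_iff, map_sub, MvPolynomial.eval_X, sub_eq_zero]
  constructor
  · rintro ⟨x, rfl⟩
    exact ⟨by simp, rfl⟩
  · rintro ⟨h1, h2⟩
    refine ⟨⟨_, h1⟩, ?_⟩
    ext (j | j)
    · rfl
    · exact h2

theorem fun_restrict (hN : IsSemialgebraic N) {F : (Fin n → ℝ) → ℝ}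
    (hF : IsSemialgebraic {z : Fin n ⊕ Unit → ℝ | z (Sum.inr ()) = F (z ∘ Sum.inl)}) :
    IsSemialgebraicFun (fun y : N => F y) := by
  have h := sa_inter (sa_comp (Sum.inl : Fin n → Fin n ⊕ Unit) hN) hF
  unfold IsSemialgebraicFun
  convert h using 1
  ext z
  simp only [Set.mem_ofPred_eq, Set.mem_inter_iff]
  constructor
  · rintro ⟨x, rfl⟩
    exact ⟨by simp, by simp⟩
  · rintro ⟨h1, h2⟩
    refine ⟨⟨_, h1⟩, ?_⟩
    ext (j | j)
    · rfl
    · exact h2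

/-- A function is semialgebraic if its cube, up to an additive constant, is. -/
theorem fun_of_cube {f g : M → ℝ} (hg : IsSemialgebraicFun g) (c : ℝ)
    (h : ∀ x, f x ^ 3 = g x - c) : IsSemialgebraicFun f := by
  -- The graph of `f` is the preimage of the graph of `g` under `(x, t) ↦ (x, t ^ 3 + c)`, by
  -- injectivity of cubing.
  have h' := sa_preimage (Sum.elim (fun i => MvPolynomial.X (R := ℝ) (Sum.inl i))
    (fun _ => MvPolynomial.X (Sum.inr ()) ^ 3 + MvPolynomial.C c) :
    Fin m ⊕ Unit → MvPolynomial (Fin m ⊕ Unit) ℝ) hg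
  unfold IsSemialgebraicFun
  convert h' using 3 with z
  refine exists_congr fun x => ?_
  rw [funext_iff, funext_iff, Sum.forall, Sum.forall]
  simp only [Sum.elim_inl, Sum.elim_inr, MvPolynomial.eval_X, map_add, map_pow,
    MvPolynomial.eval_C, ← eq_sub_iff_add_eq, ← h]
  have hs : Function.Injective fun t : ℝ => t ^ 3 := (Odd.strictMono_pow (by decide)).injective
  simp only [fun u => (hs.eq_iff (a := z (Sum.inr u)) (b := f x)).symm]

theorem sa_abs_lt {f : M → ℝ} (hf : IsSemialgebraicFun f) {r : ℝ} (hr : 0 ≤ r) :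
    IsSemialgebraic (Subtype.val '' {x : M | |f x| < r}) := by
  have h := sa_proj (sa_inter hf
    (sa_neg (MvPolynomial.X (R := ℝ) (Sum.inr () : Fin m ⊕ Unit) ^ 2 - MvPolynomial.C (r ^ 2))))
  convert h using 1
  ext z
  simp only [Set.mem_image, Set.mem_ofPred_eq, Set.mem_inter_iff, map_sub, map_pow,
    MvPolynomial.eval_X, MvPolynomial.eval_C, sub_neg, Sum.elim_inr, sq_lt_sq, abs_of_nonneg hr]
  constructor
  · rintro ⟨x, hx, rfl⟩
    exact ⟨fun _ => f x, ⟨x, rfl⟩, hx⟩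
  · rintro ⟨y, ⟨x, hx⟩, hy⟩
    obtain ⟨e1, e2⟩ := Sum.elim_eq_iff.1 hx
    subst e1 e2
    exact ⟨x, hy, rfl⟩

/-- When `π` is injective on `{|f| ≤ r}`, this image is the graph of the function that `g` induces
on `π {|f| ≤ r}`. It is obtained by eliminating `x` and the value `f x`. -/
theorem sa_graph_on {π : M → N} (hπ : IsSemialgebraicMap π) {f g : M → ℝ}
    (hf : IsSemialgebraicFun f) (hg : IsSemialgebraicFun g) {r : ℝ} (hr : 0 ≤ r) :
    IsSemialgebraic ((fun x : M => Sum.elim (π x : Fin n → ℝ) fun _ : Unit => g x) ''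
      {x | |f x| ≤ r}) := by
  have h1 := sa_comp (Sum.elim (fun i => Sum.inr (Sum.inl i)) (fun i => Sum.inl (Sum.inl i)) :
    Fin m ⊕ Fin n → (Fin n ⊕ Unit) ⊕ (Fin m ⊕ Unit)) hπ
  have h2 := sa_comp (Sum.elim (fun i => Sum.inr (Sum.inl i)) (fun i => Sum.inl (Sum.inr i)) :
    Fin m ⊕ Unit → (Fin n ⊕ Unit) ⊕ (Fin m ⊕ Unit)) hg
  have h3 := sa_comp (Sum.inr : Fin m ⊕ Unit → (Fin n ⊕ Unit) ⊕ (Fin m ⊕ Unit)) hf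
  have h4 := sa_compl (sa_pos (MvPolynomial.X (R := ℝ)
    (Sum.inr (Sum.inr ()) : (Fin n ⊕ Unit) ⊕ (Fin m ⊕ Unit)) ^ 2 - MvPolynomial.C (r ^ 2)))
  have h := sa_proj (sa_inter (sa_inter h1 h2) (sa_inter h3 h4))
  convert h using 1
  ext z
  simp only [Set.mem_image, Set.mem_ofPred_eq, Set.mem_inter_iff, Set.mem_compl_iff, map_sub,
    map_pow, MvPolynomial.eval_X, MvPolynomial.eval_C, sub_pos, Sum.elim_inr, sq_lt_sq,
    abs_of_nonneg hr, not_lt]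
  constructor
  · rintro ⟨x, hx, rfl⟩
    refine ⟨Sum.elim x fun _ => f x, ⟨⟨x, ?_⟩, ⟨x, ?_⟩⟩, ⟨x, ?_⟩, hx⟩ <;> ext (i | i) <;> rfl
  -- The three graph conditions give a priori different points of `M`; they share the coordinates
  -- stored in `y`, so they coincide.
  · rintro ⟨y, ⟨⟨x1, h1⟩, ⟨x2, h2⟩⟩, ⟨x3, h3⟩, hy⟩
    have e1 : ∀ i, y (Sum.inl i) = x1.1 i := fun i => congrFun h1 (Sum.inl i)
    have e2 : ∀ i, y (Sum.inl i) = x2.1 i := fun i => congrFun h2 (Sum.inl i)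
    have e3 : ∀ i, y (Sum.inl i) = x3.1 i := fun i => congrFun h3 (Sum.inl i)
    have e4 : x2 = x1 := Subtype.ext (funext fun i => (e2 i).symm.trans (e1 i))
    have e5 : x3 = x1 := Subtype.ext (funext fun i => (e3 i).symm.trans (e1 i))
    subst e4 e5
    refine ⟨x3, ?_, ?_⟩
    · rwa [show y (Sum.inr ()) = f x3 from congrFun h3 (Sum.inr ())] at hy
    · ext (i | i)
      · exact (congrFun h1 (Sum.inr i)).symm
      · exact (congrFun h2 (Sum.inr i)).symm

end

/-! ### Estimates along fibres, local injectivity and integrality. -/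

section
variable {m n : ℕ} {M : Set (Fin m → ℝ)} {N : Set (Fin n → ℝ)}
  {hM : IsSemialgebraic M} {hN : IsSemialgebraic N} {π : C(M, N)} {hπ : IsSemialgebraicMap π}

theorem pullback_apply (f : semialgebraicFunctions N hN) (x : M) :
    ((semialgebraicPullback hM hN π hπ).toRingHom f).1 x = f.1 (π x) := rfl

/-- On each fibre of `π`, polynomials in `g` vary at most linearly in `g`. -/
theorem eval₂_fibre_lipschitz (hMc : IsCompact M) (g : semialgebraicFunctions M hM)
    (p : Polynomial (semialgebraicFunctions N hN)) :
    ∃ C : ℝ, ∀ x y, π x = π y →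
      |(p.eval₂ (semialgebraicPullback hM hN π hπ).toRingHom g).1 x -
        (p.eval₂ (semialgebraicPullback hM hN π hπ).toRingHom g).1 y| ≤ C * |g.1 x - g.1 y| := by
  have := isCompact_iff_compactSpace.1 hMc
  have hbd : ∀ f : semialgebraicFunctions M hM, ∃ B : ℝ, ∀ x, |f.1 x| ≤ B :=
    fun f => ⟨‖f.1‖, fun x => f.1.norm_coe_le_norm x⟩
  induction p using Polynomial.induction_on with
  | C a =>
    refine ⟨0, fun x y h => ?_⟩
    rw [Polynomial.eval₂_C, pullback_apply, pullback_apply, h]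
    simp
  | add p q hp hq =>
    obtain ⟨C, hC⟩ := hp
    obtain ⟨D, hD⟩ := hq
    refine ⟨C + D, fun x y h => ?_⟩
    have h1 := hC x y h
    have h2 := hD x y h
    rw [Polynomial.eval₂_add, add_mul]
    refine le_trans ?_ (add_le_add h1 h2)
    refine le_trans (le_of_eq ?_) (abs_add_le _ _)
    congr 1
    exact add_sub_add_comm _ _ _ _
  | monomial k a hk =>
    obtain ⟨C, hC⟩ := hk
    obtain ⟨B, hB⟩ := hbd g
    rw [pow_succ, ← mul_assoc, Polynomial.eval₂_mul, Polynomial.eval₂_X]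
    generalize Polynomial.eval₂ _ g (Polynomial.C a * Polynomial.X ^ k) = f at hC ⊢
    obtain ⟨D, hD⟩ := hbd f
    refine ⟨B * C + D, fun x y h => ?_⟩
    have h1 := hC x y h
    -- The product rule for differences: the bound `B` on `|g|` multiplies the old constant, and the
    -- bound `D` on `|f|` is added.
    have e : (f * g).1 x - (f * g).1 y =
        g.1 x * (f.1 x - f.1 y) + f.1 y * (g.1 x - g.1 y) := by
      change f.1 x * g.1 x - f.1 y * g.1 y = _
      ring
    rw [e]
    refine (abs_add_le _ _).trans ?_
    rw [abs_mul, abs_mul, add_mul, mul_assoc]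
    have hB0 := (abs_nonneg _).trans (hB x)
    exact add_le_add (mul_le_mul (hB x) h1 (abs_nonneg _) hB0)
      (mul_le_mul_of_nonneg_right (hD y) (abs_nonneg _))

theorem fibre_lipschitz (hMc : IsCompact M) {g : semialgebraicFunctions M hM}
    (hg : IsSimpleGenerator (semialgebraicPullback hM hN π hπ).toRingHom g)
    (f : semialgebraicFunctions M hM) :
    ∃ C : ℝ, ∀ x y, π x = π y → |f.1 x - f.1 y| ≤ C * |g.1 x - g.1 y| := by
  obtain ⟨p, rfl⟩ := hg f
  exact eval₂_fibre_lipschitz hMc g p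

/-- The coordinate functions belong to `𝒮(M)`, so the fibrewise estimate applies to each of them and
makes their differences vanish. -/
theorem injective_on_fibre (hMc : IsCompact M) {g : semialgebraicFunctions M hM}
    (hg : IsSimpleGenerator (semialgebraicPullback hM hN π hπ).toRingHom g) {x y : M}
    (h : π x = π y) (hxy : g.1 x = g.1 y) : x = y := by
  refine Subtype.ext (funext fun i => ?_)
  obtain ⟨C, hC⟩ := fibre_lipschitz hMc hg
    ⟨⟨fun x : M => (x : Fin m → ℝ) i, (continuous_apply i).comp continuous_subtype_val⟩, fun_coord hM i⟩
  have := hC x y h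
  rw [hxy, sub_self, abs_zero, mul_zero] at this
  exact sub_eq_zero.1 (abs_nonpos_iff.1 this)

/-- Around each point there is a semialgebraic neighbourhood on which `π` is injective. -/
theorem exists_injOn (hMc : IsCompact M) {g : semialgebraicFunctions M hM}
    (hg : IsSimpleGenerator (semialgebraicPullback hM hN π hπ).toRingHom g) (x₀ : M) :
    ∃ (f : semialgebraicFunctions M hM) (r : ℝ), 0 < r ∧ f.1 x₀ = 0 ∧
      Set.InjOn π {x | |f.1 x| ≤ r} := by
  obtain ⟨σ, hσc, hσ⟩ := exists_continuous_cbrt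
  have hσ0 : σ 0 = 0 := pow_eq_zero_iff (by norm_num : (3 : ℕ) ≠ 0) |>.1 (hσ 0)
  -- The cube root of `g - g x₀` varies faster than linearly in `g` near `x₀`, against the fibrewise
  -- estimate.
  let f : semialgebraicFunctions M hM :=
    ⟨⟨fun x => σ (g.1 x - g.1 x₀), by fun_prop⟩, fun_of_cube g.2 (g.1 x₀) fun x => hσ _⟩
  have hf : ∀ x, f.1 x ^ 3 = g.1 x - g.1 x₀ := fun x => hσ _
  obtain ⟨C, hC⟩ := fibre_lipschitz hMc hg f
  have hCpos : 0 < |C| + 1 := by positivity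
  -- The factor `3 * r ^ 2` bounds `|a² + ab + b²|` when `|a|, |b| ≤ r`. Using `|C| + 1` in place of
  -- `C` gives a positive constant whatever the sign of `C`.
  obtain ⟨r, hr, hr'⟩ : ∃ r : ℝ, 0 < r ∧ (|C| + 1) * (3 * r ^ 2) < 1 := by
    have : Tendsto (fun r : ℝ => (|C| + 1) * (3 * r ^ 2)) (𝓝[>] 0) (𝓝 0) := by
      have : Continuous fun r : ℝ => (|C| + 1) * (3 * r ^ 2) := by fun_prop
      simpa using (this.tendsto 0).mono_left nhdsWithin_le_nhds
    exact ((this.eventually (gt_mem_nhds one_pos)).and self_mem_nhdsWithin).exists.imp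
      fun r h => ⟨h.2, h.1⟩
  refine ⟨f, r, hr, by change σ (g.1 x₀ - g.1 x₀) = 0; rw [sub_self, hσ0], ?_⟩
  intro x hx y hy hxy
  refine injective_on_fibre hMc hg hxy ?_
  have h1 := hC x y hxy
  rw [Set.mem_ofPred_eq] at hx hy
  set a := f.1 x with ha
  set b := f.1 y with hb
  have h2 : g.1 x - g.1 y = (a - b) * (a ^ 2 + a * b + b ^ 2) := by
    linear_combination hf y - hf x
  have h3 : |a ^ 2 + a * b + b ^ 2| ≤ 3 * r ^ 2 := by
    have ha2 : a ^ 2 ≤ r ^ 2 := sq_le_sq' (abs_le.1 hx).1 (abs_le.1 hx).2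
    have hb2 : b ^ 2 ≤ r ^ 2 := sq_le_sq' (abs_le.1 hy).1 (abs_le.1 hy).2
    rw [abs_le]
    constructor <;> nlinarith [sq_nonneg (a + b), sq_nonneg (a - b)]
  -- Otherwise `|a - b|` is at most a constant below `1` times itself.
  have h4 : a - b = 0 := by
    rw [h2, abs_mul] at h1
    by_contra hne
    have hpos := abs_pos.2 hne
    have h5 : C * (|a - b| * |a ^ 2 + a * b + b ^ 2|) ≤ (|C| + 1) * (|a - b| * (3 * r ^ 2)) :=
      mul_le_mul (by linarith [le_abs_self C]) (by gcongr) (by positivity) hCpos.le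
    nlinarith
  rw [← sub_eq_zero, h2, h4, zero_mul]

theorem isLocallyInjective (hMc : IsCompact M) {g : semialgebraicFunctions M hM}
    (hg : IsSimpleGenerator (semialgebraicPullback hM hN π hπ).toRingHom g) :
    IsLocallyInjectiveSemialgebraic π := by
  choose f r hr hf0 hinj using exists_injOn hMc hg
  -- Strict inequalities give open sets; injectivity is inherited from the closed sets `|f| ≤ r`.
  refine ⟨Set.range fun x₀ => {x | |(f x₀).1 x| < r x₀}, ?_, ?_⟩
  · refine Set.eq_univ_of_forall fun x => ⟨_, ⟨x, rfl⟩, ?_⟩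
    simp [hf0, hr]
  · rintro _ ⟨x₀, rfl⟩
    refine ⟨isOpen_lt (by fun_prop) continuous_const, sa_abs_lt (f x₀).2 (hr x₀).le, ?_⟩
    exact (hinj x₀).mono fun x hx => le_of_lt (Set.mem_ofPred_eq ▸ hx)

/-- On a set `|f| ≤ r` on which `π` is injective, `g` factors through `π`. -/
theorem exists_factor (hπ : IsSemialgebraicMap π) (hMc : IsCompact M) (f g : semialgebraicFunctions M hM) {r : ℝ}
    (hr : 0 ≤ r) (hinj : Set.InjOn π {x | |f.1 x| ≤ r}) :
    ∃ F : semialgebraicFunctions N hN, ∀ x, |f.1 x| ≤ r → F.1 (π x) = g.1 x := by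
  have := isCompact_iff_compactSpace.1 hMc
  have hK : IsCompact {x : M | |f.1 x| ≤ r} :=
    (isClosed_le (by fun_prop) continuous_const).isCompact
  have hcont : Continuous fun x : M => Sum.elim (π x : Fin n → ℝ) fun _ : Unit => g.1 x := by
    refine continuous_pi ?_
    rintro (i | i)
    · exact (continuous_apply i).comp (continuous_subtype_val.comp π.continuous)
    · exact g.1.continuous
  -- Injectivity of `π` makes the image a graph. Compactness of that graph takes the place of
  -- checking that the induced function is continuous.
  obtain ⟨F, hFc, hF, hFA⟩ := exists_extension (sa_graph_on hπ f.2 g.2 hr) (hK.image hcont) (by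
    rintro _ ⟨x, hx, rfl⟩ _ ⟨y, hy, rfl⟩ hxy
    rw [Sum.elim_comp_inl, Sum.elim_comp_inl] at hxy
    rw [hinj hx hy (Subtype.ext hxy)])
  refine ⟨⟨⟨fun y => F y, by fun_prop⟩, fun_restrict hN hF⟩, fun x hx => ?_⟩
  exact hFA _ ⟨x, hx, rfl⟩

/-- Near each point `g` agrees with some `F ∘ π`. Finitely many such neighbourhoods cover `M`, so
the product of the differences `g - F ∘ π` is zero at every point. -/
theorem isIntegralElem (hMc : IsCompact M) {g : semialgebraicFunctions M hM}
    (hg : IsSimpleGenerator (semialgebraicPullback hM hN π hπ).toRingHom g) :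
    (semialgebraicPullback hM hN π hπ).toRingHom.IsIntegralElem g := by
  have := isCompact_iff_compactSpace.1 hMc
  choose f r hr hf0 hinj using exists_injOn hMc hg
  choose F hF using fun x₀ => exists_factor (hN := hN) hπ hMc (f x₀) g (hr x₀).le (hinj x₀)
  obtain ⟨t, ht⟩ := isCompact_univ.elim_finite_subcover
    (fun x₀ => {x | |(f x₀).1 x| < r x₀}) (fun x₀ => isOpen_lt (by fun_prop) continuous_const)
    (fun x _ => Set.mem_iUnion.2 ⟨x, by simp [hf0, hr]⟩)
  refine ⟨∏ x₀ ∈ t, (Polynomial.X - Polynomial.C (F x₀)),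
    Polynomial.monic_prod_of_monic _ _ fun x₀ _ => Polynomial.monic_X_sub_C _, ?_⟩
  rw [Polynomial.eval₂_finsetProd]
  refine Subtype.ext (ContinuousMap.ext fun x => ?_)
  obtain ⟨x₀, hx₀, hx⟩ := Set.mem_iUnion₂.1 (ht (Set.mem_univ x))
  -- The factor belonging to a neighbourhood that contains `x` vanishes at `x`.
  rw [← Finset.mul_prod_erase _ _ hx₀]
  change (Polynomial.eval₂ (semialgebraicPullback hM hN π hπ).toRingHom g
    (Polynomial.X - Polynomial.C (F x₀))).1 x * _ = 0
  rw [Polynomial.eval₂_sub, Polynomial.eval₂_X, Polynomial.eval₂_C]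
  change (g.1 x - (F x₀).1 (π x)) * _ = 0
  rw [hF x₀ x (le_of_lt hx), sub_self, zero_mul]

end

end SemialgAux

theorem mainTheorem3 {m n : ℕ} (M : Set (Fin m → ℝ)) (N : Set (Fin n → ℝ))
    (hM : IsSemialgebraic M) (hN : IsSemialgebraic N) (hMc : IsCompact M) (hNc : IsCompact N)
    (π : C(M, N)) (hπ : IsSemialgebraicMap π) (hsurj : Function.Surjective π)
    (hsimple : IsSimpleRingHom (semialgebraicPullback hM hN π hπ).toRingHom) :
    IsLocallyInjectiveSemialgebraic π ∧
      (∀ g : semialgebraicFunctions M hM,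
        IsSimpleGenerator (semialgebraicPullback hM hN π hπ).toRingHom g →
          (semialgebraicPullback hM hN π hπ).toRingHom.IsIntegralElem g) ∧
      (semialgebraicPullback hM hN π hπ).toRingHom.Finite := by
  obtain ⟨g, hg⟩ := hsimple
  refine ⟨SemialgAux.isLocallyInjective hMc hg, fun g hg => SemialgAux.isIntegralElem hMc hg, ?_⟩
  exact (RingHom.isIntegral_of_isSimpleGenerator hg (SemialgAux.isIntegralElem hMc hg)).to_finite
    (RingHom.finiteType_of_isSimpleGenerator hg)
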